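/- **Setting.** Let $X=\{x\in\mathbb R^N:\varphi_1(x)=\dots=\varphi_s(x)=0\}$ be a product of $s$ real unit spheres, where $x=(x_1,\dots,x_s)$ is split into blocks $x_l\in\mathbb R^{n_l}$ and $\varphi_l=1-\|x_l\|^2$. For polynomials $f,h_1,\dots,h_m\in\mathbb R[x]$ and $b\in\mathbb R^m$, consider the generalized moment problem (GMP) $\inf\{\int f\,d\mu:\int h_i\,d\mu=b_i\ (i\le m)\}$ over finite nonnegative Borel measures $\mu$ supported on $X$, and put $K=\{(\int h_i\,d\mu)_{i\le m}:\mu\text{ a finite nonnegative Borel measure supported on }X\}$. The dual problem is $$\sup_{\lambda\in\mathbb R^m}\Big\{\sum_i b_i\lambda_i:\ f-\sum_i\lambda_ih_i\ge0\text{ on }X\Big\},$$ and for $t\ge t_{\min}$ its order-$t$ SOS strengthening is $$\sup_{\lambda\in\mathbb R^m}\Big\{\sum_i b_i\lambda_i:\ f-\sum_i\lambda_ih_i\in\Sigma[x]_{2t}+\langle\varphi\rangle_{2t}\Big\}.$$ Here $\Sigma[x]_{2t}$ is the set of sums of squares of degree at most $2t$, $\langle\varphi\rangle_{2t}=\{\sum_lk_l\varphi_l:\deg(k_l\varphi_l)\le2t\text{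 for all }l\}$, and $t_{\min}$ is the maximum of $\lceil\deg q/2\rceil$ over $q\in\{f,h_1,\dots,h_m,\varphi_1,\dots,\varphi_s\}$. The GMP *and its relaxations have duality attainment* if the dual problem, and for every $t\ge t_{\min}$ its order-$t$ strengthening, attains its supremum at a feasible $\lambda$. Let $n\ge1$. A GMP over $S\times S$, where $S=\{x\in\mathbb C^n:\|x\|=1\}$, whose objective is a real-valued polynomial and whose constraints $\int h_i\,d\mu=b_i$ have complex data (polynomials in the variables and their conjugates), is read as a GMP over $\mathbb S^{2n-1}\times\mathbb S^{2n-1}$ by substituting $x=x_{\rm Re}+\mathbf i x_{\rm Im}$, $y=y_{\rm Re}+\mathbf i y_{\rm Im}$ and splitting each constraint into its real and its imaginary part. **Corollary.** 1. (DPS hierarchy.) Let $\mathrm{SEP}$ be the cone of all finite sums $\sum_\ell w_\ell\,x^{(\ell)}x^{(\ell)*}\otimes y^{(\ell)}y^{(\ell)*}$ with $w_\ell\ge0$ and $x^{(\ell)},y^{(\ell)}\in\mathbb C^n$, and let $\rho\in\mathrm{relint}(\mathrm{SEP})$ (or, alternatively, let $b\in\mathrm{relint}(K)$ for the following GMP).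 Then the GMP $$\inf_\mu\Big\{\int1\,d\mu:\ \int xx^*\otimes yy^*\,d\mu=\rho\Big\}\quad\text{over }S\times S,$$ with one constraint for each entry of $\rho$, and its relaxations have duality attainment. Moreover, its dual in Hermitian form, $\sup\{\mathrm{Tr}(\rho\Lambda):1-(x\otimes y)^*\Lambda(x\otimes y)\ge0\text{ on }S\times S\}$ over Hermitian $\Lambda\in\mathbb C^{n^2\times n^2}$, attains its supremum. 2. (Order-2 quantum Wasserstein distance.) Let $\tau,\omega\in\mathbb C^{n\times n}$ be positive definite Hermitian matrices of trace one (or, alternatively, let $\tau,\omega$ be complex matrices of trace one such that $b\in\mathrm{relint}(K)$ for the following GMP), and let $f=\mathrm{Tr}\big((xx^*-yy^*)\overline{(xx^*-yy^*)}\big)$. Then the GMP $$\inf_\mu\Big\{\int f\,d\mu:\ \int xx^*\,d\mu=\tau,\ \int yy^*\,d\mu=\omega\Big\}\quad\text{over }S\times S,$$ with one constraint for each entry of $\tau$ and of $\omega$, and its relaxations have duality attainment. Moreover, its dual in Hermitian form, $\sup\{\mathrm{Tr}(\tau\Lambda+\omega\Gamma):f-x^*\Lambda x-y^*\Gamma y\ge0\text{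 on }S\times S\}$ over Hermitian $\Lambda,\Gamma\in\mathbb C^{n\times n}$, attains its supremum. 3. (Best rank-one approximation.) Let $\mathcal A\in\mathbb R^{n_1\times\dots\times n_a}$ be a tensor with all $n_l\ge1$, and let $\mathcal A(x)=\sum_{j_1,\dots,j_a}\mathcal A_{j_1\dots j_a}x_{1j_1}\cdots x_{aj_a}$. Then the GMP $\inf_\mu\{\int\mathcal A(x)\,d\mu:\int1\,d\mu=1\}$ over $\mathbb S^{n_1-1}\times\dots\times\mathbb S^{n_a-1}$ and its relaxations have duality attainment. -/

import Mathlib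

open MvPolynomial MeasureTheory
open scoped Kronecker ComplexOrder

/-- The supremum of `obj` over the feasible set `S` is attained by a feasible point. -/
def SupAttained {α : Type} (S : Set α) (obj : α → ℝ) : Prop :=
  ∃ a ∈ S, IsMaxOn obj S a

/-- Data of a generalized moment problem over a product of real unit spheres:
minimize `∫ f dμ` over finite Borel measures `μ` supported on `X` with `∫ h i dμ = b i` for all `i`.
The real variables are indexed by `σ`, and are grouped into blocks by `blk : σ → κ`;
the set `X` is the product, over the blocks `l : κ`, of the unit spheres in the variables of
block `l`. -/
structure SphereGMP (σ ι κ : Type) where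
  blk : σ → κ
  f : MvPolynomial σ ℝ
  h : ι → MvPolynomial σ ℝ
  b : ι → ℝ

namespace SphereGMP

variable {σ ι κ : Type} [Fintype σ] [Fintype ι] [Fintype κ] [DecidableEq κ]

/-- The sphere polynomial `φ_l = 1 - ‖x_l‖²` of block `l`. -/
noncomputable def spherePoly (G : SphereGMP σ ι κ) (l : κ) : MvPolynomial σ ℝ :=
  1 - ∑ v with G.blk v = l, X v ^ 2

/-- The product of spheres: the common real zero set of the `φ_l`. -/
def feasSet (G : SphereGMP σ ι κ) : Set (σ → ℝ) :=
  {x | ∀ l, eval x (G.spherePoly l) = 0}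

/-- The cone `K` of all vectors `(∫ h_i dμ)_i`, `μ` a finite Borel measure supported on `X`. -/
def momentCone (G : SphereGMP σ ι κ) : Set (ι → ℝ) :=
  {c | ∃ μ : Measure (σ → ℝ), IsFiniteMeasure μ ∧ μ G.feasSetᶜ = 0 ∧
    ∀ i, c i = ∫ x, eval x (G.h i) ∂μ}

/-- The relative interior assumption `b ∈ relint K`. -/
def RelintAssumption (G : SphereGMP σ ι κ) : Prop :=
  G.b ∈ intrinsicInterior ℝ G.momentCone

/-- The polynomial `f - ∑ i, λ_i h_i`. -/
noncomputable def dualPoly (G : SphereGMP σ ι κ) (lam : ι → ℝ) : MvPolynomial σ ℝ :=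
  G.f - ∑ i, C (lam i) * G.h i

/-- The dual objective `∑ i, b_i λ_i`. -/
def dualObj (G : SphereGMP σ ι κ) (lam : ι → ℝ) : ℝ :=
  ∑ i, G.b i * lam i

/-- The supremum of the dual problem `sup {∑ b_i λ_i | f - ∑ λ_i h_i ≥ 0 on X}` is attained. -/
def DualityAttainment (G : SphereGMP σ ι κ) : Prop :=
  SupAttained {lam : ι → ℝ | ∀ x ∈ G.feasSet, 0 ≤ eval x (G.dualPoly lam)} G.dualObj

/-- The truncated ideal `⟨φ⟩_d`: all `∑ l, k_l φ_l` with `deg (k_l φ_l) ≤ d` for every `l`. -/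
def truncIdeal (G : SphereGMP σ ι κ) (d : ℕ) : Set (MvPolynomial σ ℝ) :=
  {q | ∃ k : κ → MvPolynomial σ ℝ,
    (∀ l, (k l * G.spherePoly l).totalDegree ≤ d) ∧ q = ∑ l, k l * G.spherePoly l}

/-- The smallest order of a relaxation: the maximum of `⌈deg q / 2⌉` over all `q` among
`f`, the `h_i` and the `φ_l`. -/
noncomputable def tMin (G : SphereGMP σ ι κ) : ℕ :=
  max ((G.f.totalDegree + 1) / 2)
    (max (Finset.univ.sup fun i => ((G.h i).totalDegree + 1) / 2)
      (Finset.univ.sup fun l => ((G.spherePoly l).totalDegree + 1) / 2))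

/-- The supremum of the order `t` sum-of-squares strengthening of the dual problem,
`sup {∑ b_i λ_i | f - ∑ λ_i h_i ∈ Σ[x]_{2t} + ⟨φ⟩_{2t}}`, is attained. -/
def RelaxDualityAttainment (G : SphereGMP σ ι κ) (t : ℕ) : Prop :=
  SupAttained
    {lam : ι → ℝ | ∃ s q : MvPolynomial σ ℝ, IsSumSq s ∧ s.totalDegree ≤ 2 * t ∧
      q ∈ G.truncIdeal (2 * t) ∧ G.dualPoly lam = s + q}
    G.dualObj

end SphereGMP

/-! Realification of problems in complex variables. A polynomial in the variables `z` and their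
conjugates is an element of `MvPolynomial (V ⊕ V) ℂ`, where `inl v` stands for `z_v` and `inr v` for
the conjugate of `z_v`. A polynomial in the real and imaginary parts is indexed by `V ⊕ V`
too, where `inl v` stands for the real part and `inr v` for the imaginary part of `z_v`. -/

/-- The change of variables `z = z_Re + i z_Im`. -/
noncomputable def changeVars {V : Type} (p : MvPolynomial (V ⊕ V) ℂ) : MvPolynomial (V ⊕ V) ℂ :=
  aeval (Sum.elim
    (fun v => X (Sum.inl v) + C Complex.I * X (Sum.inr v))
    (fun v => X (Sum.inl v) - C Complex.I * X (Sum.inr v)) : V ⊕ V → MvPolynomial (V ⊕ V) ℂ) p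

/-- The polynomial `p_Re` in real variables. -/
noncomputable def polyRe {V : Type} (p : MvPolynomial (V ⊕ V) ℂ) : MvPolynomial (V ⊕ V) ℝ :=
  ∑ m ∈ (changeVars p).support, monomial m (coeff m (changeVars p)).re

/-- The polynomial `p_Im` in real variables. -/
noncomputable def polyIm {V : Type} (p : MvPolynomial (V ⊕ V) ℂ) : MvPolynomial (V ⊕ V) ℝ :=
  ∑ m ∈ (changeVars p).support, monomial m (coeff m (changeVars p)).im

/-- The problem `inf ∫ f dμ` subject to `∫ h_i dμ = b_i` with complex data (`f` real valued),
over a product of complex unit spheres, written in real variables: each constraint is split into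
its real and its imaginary part. -/
noncomputable def realifyGMP {V ι κ : Type} (blk : V → κ) (f : MvPolynomial (V ⊕ V) ℂ)
    (h : ι → MvPolynomial (V ⊕ V) ℂ) (b : ι → ℂ) : SphereGMP (V ⊕ V) (ι ⊕ ι) κ where
  blk := Sum.elim blk blk
  f := polyRe f
  h := Sum.elim (fun i => polyRe (h i)) (fun i => polyIm (h i))
  b := Sum.elim (fun i => (b i).re) (fun i => (b i).im)

/-! The two quantum problems have complex variables `x = z_(0,·)` and `y = z_(1,·)` in `ℂⁿ`. -/

/-- The variable `x_i` (for `s = 0`) or `y_i` (for `s = 1`). -/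
noncomputable def zVar {n : ℕ} (s : Fin 2) (i : Fin n) :
    MvPolynomial ((Fin 2 × Fin n) ⊕ (Fin 2 × Fin n)) ℂ := X (Sum.inl (s, i))

/-- The conjugate variable of `x_i` (for `s = 0`) or `y_i` (for `s = 1`). -/
noncomputable def zBar {n : ℕ} (s : Fin 2) (i : Fin n) :
    MvPolynomial ((Fin 2 × Fin n) ⊕ (Fin 2 × Fin n)) ℂ := X (Sum.inr (s, i))

/-- The complex unit sphere in `ℂⁿ`. -/
def complexSphere (n : ℕ) : Set (Fin n → ℂ) := {x | ∑ i, ‖x i‖ ^ 2 = 1}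

/-- The rank one matrix `x x^*`. -/
def outer {n : ℕ} (x : Fin n → ℂ) : Matrix (Fin n) (Fin n) ℂ := Matrix.vecMulVec x (star x)

/-- The quadratic form `v^* Λ v` (real for Hermitian `Λ`). -/
def quadForm {m : Type} [Fintype m] (M : Matrix m m ℂ) (v : m → ℂ) : ℝ :=
  (star v ⬝ᵥ M.mulVec v).re

/-- The cone of separable bipartite states: all finite sums `∑ w_ℓ x_ℓ x_ℓ^* ⊗ y_ℓ y_ℓ^*`
with `w_ℓ ≥ 0`. -/
def separableCone (n : ℕ) : Set (Matrix (Fin n × Fin n) (Fin n × Fin n) ℂ) :=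
  {ρ | ∃ (r : ℕ) (w : Fin r → ℝ) (x y : Fin r → Fin n → ℂ), (∀ l, 0 ≤ w l) ∧
    ρ = ∑ l, w l • (outer (x l) ⊗ₖ outer (y l))}

/-- The problem `inf ∫ 1 dμ` subject to `∫ x x^* ⊗ y y^* dμ = ρ`, in real variables. The constraint
with index `((i, k), (j, l))` is `∫ x_i conj(x_j) y_k conj(y_l) dμ = ρ_{(i,k),(j,l)}`. -/
noncomputable def dpsGMP (n : ℕ) (ρ : Matrix (Fin n × Fin n) (Fin n × Fin n) ℂ) :
    SphereGMP ((Fin 2 × Fin n) ⊕ (Fin 2 × Fin n))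
      (((Fin n × Fin n) × (Fin n × Fin n)) ⊕ ((Fin n × Fin n) × (Fin n × Fin n))) (Fin 2) :=
  realifyGMP Prod.fst 1
    (fun p => zVar 0 p.1.1 * zBar 0 p.2.1 * (zVar 1 p.1.2 * zBar 1 p.2.2))
    (fun p => ρ p.1 p.2)

/-- The supremum of `Tr (ρ Λ)` over Hermitian `Λ` with
`1 - (x ⊗ y)^* Λ (x ⊗ y) ≥ 0` for all complex unit vectors `x`, `y` is attained. -/
def DPSDualAttained (n : ℕ) (ρ : Matrix (Fin n × Fin n) (Fin n × Fin n) ℂ) : Prop :=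
  SupAttained
    {L : Matrix (Fin n × Fin n) (Fin n × Fin n) ℂ | L.IsHermitian ∧
      ∀ x ∈ complexSphere n, ∀ y ∈ complexSphere n,
        0 ≤ 1 - quadForm L (fun p => x p.1 * y p.2)}
    (fun L => (ρ * L).trace.re)

/-- The cost `Tr ((x x^* - y y^*) conj(x x^* - y y^*))` as a polynomial in `x`, `y` and
their conjugates. -/
noncomputable def costPoly (n : ℕ) : MvPolynomial ((Fin 2 × Fin n) ⊕ (Fin 2 × Fin n)) ℂ :=
  Matrix.trace
    ((Matrix.of fun i j : Fin n => zVar 0 i * zBar 0 j - zVar 1 i * zBar 1 j) *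
      (Matrix.of fun i j : Fin n => zBar 0 i * zVar 0 j - zBar 1 i * zVar 1 j))

/-- The same cost as a function of two complex vectors. -/
noncomputable def cost {n : ℕ} (x y : Fin n → ℂ) : ℝ :=
  (((outer x - outer y) * (outer x - outer y).map (starRingEnd ℂ)).trace).re

/-- The problem `inf ∫ f dμ` subject to `∫ x x^* dμ = τ` and `∫ y y^* dμ = ω` in real variables,
where `f` is the above cost. -/
noncomputable def wassersteinGMP (n : ℕ) (τ ω : Matrix (Fin n) (Fin n) ℂ) :
    SphereGMP ((Fin 2 × Fin n) ⊕ (Fin 2 × Fin n))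
      (((Fin n × Fin n) ⊕ (Fin n × Fin n)) ⊕ ((Fin n × Fin n) ⊕ (Fin n × Fin n))) (Fin 2) :=
  realifyGMP Prod.fst (costPoly n)
    (Sum.elim (fun p => zVar 0 p.1 * zBar 0 p.2) (fun p => zVar 1 p.1 * zBar 1 p.2))
    (Sum.elim (fun p => τ p.1 p.2) (fun p => ω p.1 p.2))

/-- The supremum of `Tr (τ Λ + ω Γ)` over Hermitian `Λ`, `Γ` with
`f(x, y) - x^* Λ x - y^* Γ y ≥ 0` for all complex unit vectors `x`, `y` is attained. -/
def WassersteinDualAttained (n : ℕ) (τ ω : Matrix (Fin n) (Fin n) ℂ) : Prop :=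
  SupAttained
    {P : Matrix (Fin n) (Fin n) ℂ × Matrix (Fin n) (Fin n) ℂ |
      P.1.IsHermitian ∧ P.2.IsHermitian ∧
      ∀ x ∈ complexSphere n, ∀ y ∈ complexSphere n,
        0 ≤ cost x y - quadForm P.1 x - quadForm P.2 y}
    (fun P => (τ * P.1 + ω * P.2).trace.re)

/-- The problem `inf ∫ A(x) dμ` subject to `∫ 1 dμ = 1` over a product of real unit spheres, where
`A(x) = ⟨A, x_1 ⊗ ⋯ ⊗ x_a⟩` for a real tensor `A` of format `n_1 × ⋯ × n_a`. -/
noncomputable def tensorGMP {a : ℕ} (n : Fin a → ℕ) (A : ((l : Fin a) → Fin (n l)) → ℝ) :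
    SphereGMP ((l : Fin a) × Fin (n l)) (Fin 1) (Fin a) where
  blk := Sigma.fst
  f := ∑ j : (l : Fin a) → Fin (n l), C (A j) * ∏ l, X ⟨l, j l⟩
  h := fun _ => 1
  b := fun _ => 1

/-! The common core is a strict-feasibility argument. Let h(x) be the vector of values of the
constraint polynomials at x. `StrictlyFeasible` asks that b lie in K and that, for each x in X, some
step b - ε h(x) with ε > 0 stay in K. Relative interior implies this, since Dirac measures put every
h(x) in K. On a superlevel set of the dual objective, h(x)·λ ≤ f(x) by feasibility, while weak
duality for b - ε h(x) bounds h(x)·λ from below. So λ is bounded modulo the orthogonal complement of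
the span of the h(x). Moving λ in that complement changes neither the objective nor the function f -
∑ λ_i h_i on X, so λ may be projected onto the span. If the admissible functions on X form a closed
set, compactness gives a maximizer (`StrictlyFeasible.supAttained_of_isClosed`).

For the nonnegativity dual closedness is immediate. For the order-t strengthening,
`exists_sos_add_truncIdeal_iff` turns the algebraic constraint into membership of the restriction to
X in the cone of squares of polynomials of degree at most t. This uses that leading terms of squares
cannot cancel, and that every polynomial of degree at most d vanishing on X lies in ⟨φ⟩_d. The cone
is closed by a Gram matrix argument (`isClosed_closure_squares`). Feasible λ exist because f plus a
large constant is a sum of squares on X with the right degrees, and the constant 1 is a combination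
of the h_i on X.

In the applications strict feasibility is checked directly: inside SEP, with product measures of
prescribed marginals, or trivially for tensors. Optimal real multipliers become Hermitian matrices
by taking Hermitian parts. -/

section SumSq

/-! ### Degree bounds in sums of squares. -/

variable {σ : Type} [Finite σ]

-- Nonnegative leading coefficients rule out cancellation at the top: at equal degrees they add to a
-- positive number unless `p` is zero. Squares have nonnegative leading coefficients, so no summand
-- exceeds the degree of a sum of squares.
open MonomialOrder in
lemma degLex_degree_le_add_of_leadingCoeff_nonneg [LinearOrder σ] {p q : MvPolynomial σ ℝ}
    (hp : 0 ≤ degLex.leadingCoeff p) (hq : 0 ≤ degLex.leadingCoeff q) :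
    degLex.toSyn (degLex.degree p) ≤ degLex.toSyn (degLex.degree (p + q)) ∧
      0 ≤ degLex.leadingCoeff (p + q) := by
  rcases lt_trichotomy (degLex.toSyn (degLex.degree p)) (degLex.toSyn (degLex.degree q))
    with h | h | h
  · rw [add_comm, degree_add_of_lt h, leadingCoeff_add_of_lt h]
    exact ⟨h.le, hq⟩
  · have hpq : degLex.degree p = degLex.degree q := degLex.toSyn.injective h
    by_cases hp0 : p = 0
    · subst hp0
      simpa using hq
    have hpos : 0 < degLex.leadingCoeff p :=
      lt_of_le_of_ne hp (Ne.symm (leadingCoeff_ne_zero_iff.2 hp0))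
    have hc : 0 < coeff (degLex.degree p) (p + q) := by
      rw [coeff_add]
      have h2 : coeff (degLex.degree p) q = degLex.leadingCoeff q := by rw [hpq]; rfl
      rw [h2]
      exact add_pos_of_pos_of_nonneg hpos hq
    have hle := degLex.le_degree (mem_support_iff.2 hc.ne')
    have hge : degLex.toSyn (degLex.degree (p + q)) ≤ degLex.toSyn (degLex.degree p) :=
      degree_add_le.trans (by rw [← h, sup_idem])
    refine ⟨hle, ?_⟩
    have : degLex.degree (p + q) = degLex.degree p :=
      degLex.toSyn.injective (le_antisymm hge hle)
    unfold MonomialOrder.leadingCoeff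
    rw [this]
    exact hc.le
  · rw [degree_add_of_lt h, leadingCoeff_add_of_lt h]
    exact ⟨le_rfl, hp⟩

open MonomialOrder in
lemma IsSumSq.leadingCoeff_nonneg [LinearOrder σ] {s : MvPolynomial σ ℝ} (hs : IsSumSq s) :
    0 ≤ degLex.leadingCoeff s := by
  induction hs with
  | zero => simp
  | sq_add a _ ih =>
    refine (degLex_degree_le_add_of_leadingCoeff_nonneg ?_ ih).2
    rw [leadingCoeff_mul]
    exact mul_self_nonneg _

/-- A sum of squares of degree at most `2 t` is a sum of squares of polynomials of degree at
most `t`. -/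
lemma IsSumSq.mem_closure_of_totalDegree_le {s : MvPolynomial σ ℝ} (hs : IsSumSq s) {t : ℕ}
    (ht : s.totalDegree ≤ 2 * t) :
    s ∈ AddSubmonoid.closure
      {p : MvPolynomial σ ℝ | ∃ q : MvPolynomial σ ℝ, q.totalDegree ≤ t ∧ p = q * q} := by
  classical
  -- Any order of the variables will do: `degLex` is graded, so comparing leading monomials compares
  -- total degrees.
  let : LinearOrder σ := linearOrderOfSTO WellOrderingRel
  induction hs with
  | zero => exact zero_mem _
  | @sq_add a s hs ih =>
    have ha : 0 ≤ MonomialOrder.degLex.leadingCoeff (a * a) := by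
      rw [MonomialOrder.leadingCoeff_mul]; exact mul_self_nonneg _
    have h1 := degLex_totalDegree_monotone
      (degLex_degree_le_add_of_leadingCoeff_nonneg ha hs.leadingCoeff_nonneg).1
    have h2 := degLex_totalDegree_monotone
      (degLex_degree_le_add_of_leadingCoeff_nonneg hs.leadingCoeff_nonneg ha).1
    rw [add_comm s] at h2
    refine add_mem (AddSubmonoid.subset_closure ⟨a, ?_, rfl⟩) (ih (h2.trans ht))
    by_cases h0 : a = 0
    · simp [h0]
    have h3 := totalDegree_mul_of_isDomain h0 h0
    omega

end SumSq

/-! ### The truncated vanishing ideal of a product of spheres. -/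

namespace SphereGMP

variable {σ ι κ : Type} [Fintype σ] [DecidableEq κ]

section Ideal

variable (G : SphereGMP σ ι κ)

lemma mem_feasSet_iff {x : σ → ℝ} :
    x ∈ G.feasSet ↔ ∀ l, ∑ v with G.blk v = l, x v ^ 2 = 1 := by
  refine forall_congr' fun l => ?_
  simp [spherePoly, sub_eq_zero, eq_comm (a := (1 : ℝ))]

lemma totalDegree_monomial_mul_spherePoly_le (m : σ →₀ ℕ) (l : κ) :
    (monomial m (1 : ℝ) * G.spherePoly l).totalDegree ≤ m.degree + 2 := by
  refine (totalDegree_mul _ _).trans (add_le_add (totalDegree_monomial_le _ _) ?_)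
  unfold spherePoly
  refine (totalDegree_sub _ _).trans (max_le (by simp) ?_)
  refine totalDegree_finsetSum_le fun v _ => ?_
  simp [totalDegree_X_pow]

/-- A polynomial of degree at most one in one variable of each block is zero if it vanishes on
the product of spheres. -/
lemma eq_zero_of_reduced_of_vanishing {v : κ → σ} (hv : ∀ l, G.blk (v l) = l)
    {r : MvPolynomial σ ℝ}
    (hr : r ∈ restrictSupport ℝ {m : σ →₀ ℕ | ∀ l, m (v l) ≤ 1})
    (h0 : ∀ x ∈ G.feasSet, eval x r = 0) : r = 0 := by
  classical
  -- If all other coordinates lie in [0, δ], their squares sum to less than 1 in each block. The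
  -- sphere equation can then be solved for the chosen coordinate `v l`, with two distinct roots.
  set δ : ℝ := 1 / (Fintype.card σ + 1) with hδ
  have hδ0 : 0 < δ := by positivity
  refine funext_set (fun _ => Set.Icc 0 δ) (fun _ => Set.Icc_infinite hδ0) fun y hy => ?_
  rw [map_zero]
  -- Freeze all coordinates at `y` except the chosen one of each block.
  let g : σ → MvPolynomial σ ℝ := fun u => if v (G.blk u) = u then X u else C (y u)
  have hg : bind₁ g r = 0 := by
    let c : κ → ℝ := fun l =>
      Real.sqrt (1 - ∑ u ∈ ({u | G.blk u = l} : Finset σ).erase (v l), y u ^ 2)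
    have hc0 : ∀ l, 0 < 1 - ∑ u ∈ ({u | G.blk u = l} : Finset σ).erase (v l), y u ^ 2 := by
      intro l
      have h1 : ∑ u ∈ ({u | G.blk u = l} : Finset σ).erase (v l), y u ^ 2
          ≤ ∑ _u : σ, δ ^ 2 := by
        refine (Finset.sum_le_univ_sum_of_nonneg fun u => sq_nonneg _).trans ?_
        refine Finset.sum_le_sum fun u _ => ?_
        have := hy u trivial
        exact pow_le_pow_left₀ this.1 this.2 2
      rw [Finset.sum_const, Finset.card_univ, nsmul_eq_mul] at h1
      have h2 : (Fintype.card σ : ℝ) * δ ^ 2 < 1 := by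
        rw [hδ, div_pow, one_pow, mul_one_div, div_lt_one (by positivity)]
        nlinarith [(Nat.cast_nonneg (Fintype.card σ) : (0 : ℝ) ≤ _)]
      linarith
    -- The frozen polynomial vanishes on a grid: two values ±c for each chosen variable, where its
    -- degree is at most one, and a single value for each frozen variable, which no longer occurs.
    refine eq_zero_of_eval_zero_at_prod_finset _
      (fun u => if v (G.blk u) = u then {c (G.blk u), -c (G.blk u)} else {0}) ?_ ?_
    · intro u
      have hgu : ∀ w, degreeOf u (g w) ≤ if w = u ∧ v (G.blk u) = u then 1 else 0 := by
        intro w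
        by_cases hw : v (G.blk w) = w
        · simp only [g, if_pos hw, degreeOf_X]
          by_cases huw : u = w
          · subst huw; simp [hw]
          · simp [huw]
        · simp [g, if_neg hw, degreeOf_C]
      have hdeg : degreeOf u (bind₁ g r) ≤ if v (G.blk u) = u then 1 else 0 := by
        conv_lhs => rw [r.as_sum, map_sum]
        refine (degreeOf_sum_le _ _ _).trans (Finset.sup_le fun m hm => ?_)
        rw [bind₁_monomial]
        refine (degreeOf_C_mul_le _ _ _).trans ((degreeOf_prod_le _ _ _).trans ?_)
        have hm1 : ∀ l, m (v l) ≤ 1 := by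
          rw [mem_restrictSupport_iff] at hr
          exact hr hm
        calc ∑ w ∈ m.support, degreeOf u (g w ^ m w)
            ≤ ∑ w ∈ m.support, if u = w then (if v (G.blk u) = u then 1 else 0) else 0 := by
              refine Finset.sum_le_sum fun w _ => (degreeOf_pow_le _ _ _).trans ?_
              refine (Nat.mul_le_mul_left _ (hgu w)).trans ?_
              by_cases hwu : w = u
              · subst hwu
                by_cases hw : v (G.blk w) = w
                · have := hm1 (G.blk w)
                  rw [hw] at this
                  simpa [hw] using this
                · simp [hw]
              · simp [hwu]
          _ ≤ _ := by
              rw [Finset.sum_ite_eq]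
              split_ifs <;> simp
      refine hdeg.trans_lt ?_
      split_ifs with hu
      · rw [Finset.card_pair]
        · norm_num
        · have : 0 < c (G.blk u) := Real.sqrt_pos.2 (hc0 _)
          intro h; linarith
      · simp
    · intro z hz
      rw [← aeval_eq_eval, aeval_bind₁, aeval_eq_eval]
      refine h0 _ (G.mem_feasSet_iff.2 fun l => ?_)
      have hmem : v l ∈ ({u | G.blk u = l} : Finset σ) := by simp [hv]
      rw [← Finset.add_sum_erase _ _ hmem]
      have h1 : (aeval z (g (v l)) : ℝ) ^ 2 = c l ^ 2 := by
        have := hz (v l)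
        simp only [hv, if_true, Finset.mem_insert, Finset.mem_singleton] at this
        simp only [g, hv, if_true, aeval_X]
        rcases this with h | h
        · rw [h]
        · rw [h, neg_sq]
      have h2 : ∑ u ∈ ({u | G.blk u = l} : Finset σ).erase (v l), (aeval z (g u) : ℝ) ^ 2
          = ∑ u ∈ ({u | G.blk u = l} : Finset σ).erase (v l), y u ^ 2 := by
        refine Finset.sum_congr rfl fun u hu => ?_
        simp only [Finset.mem_erase, Finset.mem_filter, Finset.mem_univ, true_and] at hu
        have : v (G.blk u) ≠ u := by rw [hu.2]; exact hu.1.symm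
        simp [g, this]
      rw [h1, h2, Real.sq_sqrt (hc0 l).le]
      ring
  have h1 : eval y (bind₁ g r) = eval y r := by
    rw [← aeval_eq_eval, aeval_bind₁]
    congr 2
    funext u
    by_cases hu : v (G.blk u) = u
    · simp [g, hu]
    · simp [g, hu]
  rw [← h1, hg, map_zero]

variable [Fintype κ]

/-- The truncated ideal as a subspace. -/
def truncSubmodule (d : ℕ) : Submodule ℝ (MvPolynomial σ ℝ) where
  carrier := G.truncIdeal d
  zero_mem' := ⟨0, by simp, by simp⟩
  add_mem' := by
    rintro _ _ ⟨k, hk, rfl⟩ ⟨k', hk', rfl⟩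
    refine ⟨k + k', fun l => ?_, ?_⟩
    · rw [Pi.add_apply, add_mul]
      exact (totalDegree_add _ _).trans (max_le (hk l) (hk' l))
    · simp [add_mul, Finset.sum_add_distrib]
  smul_mem' := by
    rintro c _ ⟨k, hk, rfl⟩
    refine ⟨c • k, fun l => ?_, ?_⟩
    · rw [Pi.smul_apply, smul_mul_assoc]
      exact (totalDegree_smul_le _ _).trans (hk l)
    · simp [Finset.smul_sum]

lemma eval_eq_zero_of_mem_truncIdeal {d : ℕ} {q : MvPolynomial σ ℝ} (hq : q ∈ G.truncIdeal d)
    {x : σ → ℝ} (hx : x ∈ G.feasSet) : eval x q = 0 := by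
  obtain ⟨k, -, rfl⟩ := hq
  rw [map_sum]
  exact Finset.sum_eq_zero fun l _ => by rw [map_mul, hx l, mul_zero]

variable {G} {v : κ → σ} (hv : ∀ l, G.blk (v l) = l)
include hv

/-- Division by the sphere polynomials: modulo `G.spherePoly l`, the square of the variable `v l`
becomes 1 minus the other squares of its block. The total degree does not grow, and the exponents of
the chosen variables drop by two in total, which drives the induction. -/
lemma monomial_mem_reduced_sup_truncSubmodule (d : ℕ) (m : σ →₀ ℕ) (hm : m.degree ≤ d) :
    monomial m (1 : ℝ) ∈
      restrictSupport ℝ {m : σ →₀ ℕ | ∀ l, m (v l) ≤ 1} ⊔ G.truncSubmodule d := by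
  classical
  induction hw : ∑ l, m (v l) using Nat.strong_induction_on generalizing m with
  | _ w ih =>
  by_cases hred : ∀ l, m (v l) ≤ 1
  · refine Submodule.mem_sup_left ?_
    rw [mem_restrictSupport_iff]
    intro n hn
    have := support_monomial_subset hn
    rw [Finset.mem_singleton] at this
    subst this
    exact hred
  push Not at hred
  obtain ⟨l, hl⟩ := hred
  set m' : σ →₀ ℕ := m - Finsupp.single (v l) 2 with hm'
  have hmm : m = m' + Finsupp.single (v l) 2 := by
    rw [hm', tsub_add_cancel_of_le]
    rw [Finsupp.single_le_iff]; omega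
  have hdeg : m.degree = m'.degree + 2 := by
    rw [hmm, map_add, Finsupp.degree_single]
  have hW : ∑ k, m (v k) = ∑ k, m' (v k) + 2 := by
    rw [hmm]
    simp only [Finsupp.add_apply, Finset.sum_add_distrib]
    congr 1
    rw [Finset.sum_eq_single l]
    · simp
    · intro k _ hk
      rw [Finsupp.single_apply, if_neg]
      intro h
      exact hk (by rw [← hv k, ← h, hv l])
    · simp
  have key : monomial m (1 : ℝ) = monomial m' 1
      - ∑ u ∈ {u | G.blk u = l}.toFinset.erase (v l), monomial (m' + Finsupp.single u 2) 1
      - monomial m' 1 * G.spherePoly l := by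
    have hmem : v l ∈ {u | G.blk u = l}.toFinset := by simp [hv]
    have : G.spherePoly l = 1 - (X (v l) ^ 2
        + ∑ u ∈ {u | G.blk u = l}.toFinset.erase (v l), X u ^ 2) := by
      rw [Finset.add_sum_erase _ (fun u => (X u : MvPolynomial σ ℝ) ^ 2) hmem]
      simp [spherePoly]
    have hX : ∀ u : σ, monomial (m' + Finsupp.single u 2) (1 : ℝ) = monomial m' 1 * X u ^ 2 := by
      intro u
      rw [X_pow_eq_monomial, monomial_mul, one_mul]
    rw [this, hmm, hX]
    simp only [hX, ← Finset.mul_sum]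
    ring
  rw [key]
  refine sub_mem (sub_mem (ih _ (by omega) m' (by omega) rfl) (sum_mem fun u hu => ?_)) ?_
  · refine ih _ ?_ _ ?_ rfl
    · rw [← hw, hW]
      simp only [Finsupp.add_apply, Finset.sum_add_distrib]
      have : ∑ k, (Finsupp.single u 2) (v k) = 0 := by
        refine Finset.sum_eq_zero fun k _ => ?_
        rw [Finsupp.single_apply, if_neg]
        rintro rfl
        simp only [Finset.mem_erase, Set.mem_toFinset, Set.mem_ofPred_eq, hv] at hu
        exact hu.1 (by rw [hu.2])
      omega
    · rw [map_add, Finsupp.degree_single]; omega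
  · refine Submodule.mem_sup_right ⟨Pi.single l (monomial m' 1), fun k => ?_, ?_⟩
    · by_cases hk : k = l
      · subst hk
        rw [Pi.single_eq_same]
        exact (G.totalDegree_monomial_mul_spherePoly_le m' k).trans (by omega)
      · simp [Pi.single_eq_of_ne hk]
    · rw [Finset.sum_eq_single l]
      · simp
      · intro k _ hk
        simp [Pi.single_eq_of_ne hk]
      · simp

/-- A polynomial of degree at most `d` vanishing on the product of spheres is in the truncated
ideal of degree `d`. -/
lemma mem_truncIdeal_of_vanishing {d : ℕ} {p : MvPolynomial σ ℝ} (hp : p.totalDegree ≤ d)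
    (h0 : ∀ x ∈ G.feasSet, eval x p = 0) : p ∈ G.truncIdeal d := by
  have hmem : p ∈ restrictSupport ℝ {m : σ →₀ ℕ | ∀ l, m (v l) ≤ 1} ⊔ G.truncSubmodule d := by
    rw [p.as_sum]
    refine sum_mem fun m hm => ?_
    have : monomial m (coeff m p) = coeff m p • monomial m (1 : ℝ) := by
      rw [smul_monomial, smul_eq_mul, mul_one]
    rw [this]
    exact Submodule.smul_mem _ _
      (monomial_mem_reduced_sup_truncSubmodule hv d m ((le_totalDegree hm).trans hp))
  obtain ⟨r, hr, q, hq, rfl⟩ := Submodule.mem_sup.1 hmem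
  have : r = 0 := by
    refine G.eq_zero_of_reduced_of_vanishing hv hr fun x hx => ?_
    have := h0 x hx
    rwa [map_add, G.eval_eq_zero_of_mem_truncIdeal hq hx, add_zero] at this
  subst this
  rw [zero_add]
  exact hq

end Ideal

end SphereGMP

/-! ### Closedness of cones of sums of squares. -/

section ClosedCone

open Filter Topology in
/-- A continuous map which is homogeneous of degree two and vanishes only at zero has closed
range. -/
lemma isClosed_range_of_homogeneous_two {V F : Type} [NormedAddCommGroup V] [NormedSpace ℝ V]
    [FiniteDimensional ℝ V] [NormedAddCommGroup F] [NormedSpace ℝ F] {f : V → F}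
    (hf : Continuous f) (hhom : ∀ (c : ℝ) a, f (c • a) = c ^ 2 • f a)
    (hzero : ∀ a, f a = 0 → a = 0) : IsClosed (Set.range f) := by
  have : ProperSpace V := FiniteDimensional.proper ℝ V
  -- Take the minimum of ‖f‖ on the unit sphere, positive because f vanishes only at 0, and scale.
  -- The sphere is empty when `V` is trivial.
  obtain ⟨δ, hδ, hbound⟩ : ∃ δ > 0, ∀ a, δ * ‖a‖ ^ 2 ≤ ‖f a‖ := by
    rcases (Metric.sphere (0 : V) 1).eq_empty_or_nonempty with he | hne
    · refine ⟨1, one_pos, fun a => ?_⟩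
      by_cases ha : a = 0
      · simp [ha]
      · exact absurd (he ▸ (by simp [norm_smul, ha] : ‖a‖⁻¹ • a ∈ Metric.sphere (0 : V) 1))
          (Set.notMem_empty _)
    · obtain ⟨a₀, ha₀, hmin⟩ := (isCompact_sphere (0 : V) 1).exists_isMinOn hne hf.norm.continuousOn
      refine ⟨‖f a₀‖, norm_pos_iff.2 fun h => ?_, fun a => ?_⟩
      · rw [hzero _ h] at ha₀
        simp at ha₀
      · by_cases ha : a = 0
        · simp [ha]
        have h1 : ‖a‖⁻¹ • a ∈ Metric.sphere (0 : V) 1 := by simp [norm_smul, ha]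
        have h2 : ‖f a₀‖ ≤ ‖f (‖a‖⁻¹ • a)‖ := hmin h1
        rw [hhom, norm_smul, norm_pow, norm_inv, norm_norm] at h2
        have h3 : 0 < ‖a‖ := norm_pos_iff.2 ha
        calc ‖f a₀‖ * ‖a‖ ^ 2 ≤ (‖a‖⁻¹ ^ 2 * ‖f a‖) * ‖a‖ ^ 2 := by gcongr
          _ = ‖f a‖ := by field_simp
  refine isClosed_of_closure_subset fun z hz => ?_
  obtain ⟨u, hu, hlim⟩ := mem_closure_iff_seq_limit.1 hz
  -- Eventually ‖f a‖ < ‖z‖ + 1, so ‖a‖² ≤ (‖z‖ + 1)/δ; the radius then follows from ‖a‖ ≤ 1 + ‖a‖².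
  have hK : IsClosed (f '' Metric.closedBall 0 (1 + (‖z‖ + 1) / δ)) :=
    ((isCompact_closedBall _ _).image hf).isClosed
  refine Set.image_subset_range _ _ (hK.mem_of_tendsto hlim ?_)
  have hev : ∀ᶠ n in atTop, ‖u n‖ < ‖z‖ + 1 :=
    hlim.norm.eventually_lt_const (lt_add_one _)
  filter_upwards [hev] with n hn
  obtain ⟨a, ha⟩ := hu n
  refine ⟨a, ?_, ha⟩
  have h1 := hbound a
  rw [ha] at h1
  have h2 : ‖a‖ ^ 2 ≤ (‖z‖ + 1) / δ := by
    rw [le_div_iff₀ hδ]; linarith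
  rw [mem_closedBall_zero_iff]
  nlinarith [norm_nonneg a]

variable {Y : Type} [TopologicalSpace Y] [CompactSpace Y]

/-- The cone of sums of squares of elements of a finite-dimensional space of continuous functions
is closed. -/
lemma isClosed_closure_squares (E : Submodule ℝ C(Y, ℝ)) [FiniteDimensional ℝ E] :
    IsClosed (AddSubmonoid.closure {g : C(Y, ℝ) | ∃ q ∈ E, g = q * q} : Set C(Y, ℝ)) := by
  classical
  let r := Module.finrank ℝ E
  let β : Module.Basis (Fin r) ℝ E := Module.finBasis ℝ E
  -- A sum of any number of squares has a positive semidefinite Gram matrix in the basis `β`.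
  -- Factoring it as BᵀB rewrites the sum with only `r` squares, so the cone is the range of one
  -- quadratic map.
  let T : (Fin r → Fin r → ℝ) → C(Y, ℝ) := fun A =>
    ∑ i, (∑ j, A i j • (β j : C(Y, ℝ))) * (∑ j, A i j • (β j : C(Y, ℝ)))
  have hmem : ∀ a : Fin r → ℝ, ∑ j, a j • (β j : C(Y, ℝ)) ∈ E := fun a =>
    sum_mem fun j _ => E.smul_mem _ (β j).2
  have hrange : (AddSubmonoid.closure {g : C(Y, ℝ) | ∃ q ∈ E, g = q * q} : Set C(Y, ℝ))
      = Set.range T := by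
    apply Set.Subset.antisymm
    · intro g hg
      have hG : ∃ M : Matrix (Fin r) (Fin r) ℝ, M.PosSemidef ∧
          g = ∑ j, ∑ k, M j k • ((β j : C(Y, ℝ)) * (β k : C(Y, ℝ))) := by
        refine AddSubmonoid.closure_induction (motive := fun g _ => ∃ M : Matrix (Fin r) (Fin r) ℝ,
          M.PosSemidef ∧ g = ∑ j, ∑ k, M j k • ((β j : C(Y, ℝ)) * (β k : C(Y, ℝ))))
          ?_ ⟨0, Matrix.PosSemidef.zero, by simp⟩ ?_ hg
        · rintro _ ⟨q, hq, rfl⟩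
          refine ⟨Matrix.vecMulVec (β.repr ⟨q, hq⟩) (star (β.repr ⟨q, hq⟩ : Fin r → ℝ)),
            Matrix.posSemidef_vecMulVec_self_star _, ?_⟩
          have h1 : q = ∑ j, β.repr ⟨q, hq⟩ j • (β j : C(Y, ℝ)) := by
            have := congrArg E.subtype (β.sum_repr ⟨q, hq⟩)
            simp only [map_sum, map_smul, Submodule.subtype_apply] at this
            exact this.symm
          conv_lhs => rw [h1]
          rw [Finset.sum_mul_sum]
          refine Finset.sum_congr rfl fun j _ => Finset.sum_congr rfl fun k _ => ?_
          rw [smul_mul_smul_comm]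
          rfl
        · rintro _ _ _ _ ⟨M, hM, rfl⟩ ⟨M', hM', rfl⟩
          refine ⟨M + M', hM.add hM', ?_⟩
          simp [add_smul, Finset.sum_add_distrib]
      obtain ⟨M, hM, rfl⟩ := hG
      obtain ⟨B, rfl⟩ : ∃ B : Matrix (Fin r) (Fin r) ℝ, M = B.conjTranspose * B := by
        open scoped MatrixOrder in
        exact CStarAlgebra.nonneg_iff_eq_star_mul_self.1 hM.nonneg
      refine ⟨B, ?_⟩
      simp only [T, Finset.sum_mul_sum, smul_mul_smul_comm]
      rw [Finset.sum_comm]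
      refine Finset.sum_congr rfl fun j _ => ?_
      rw [Finset.sum_comm]
      refine Finset.sum_congr rfl fun k _ => ?_
      rw [← Finset.sum_smul]
      simp [Matrix.mul_apply]
    · rintro _ ⟨A, rfl⟩
      exact sum_mem fun i _ => AddSubmonoid.subset_closure ⟨_, hmem _, rfl⟩
  rw [hrange]
  refine isClosed_range_of_homogeneous_two ?_ ?_ ?_
  · fun_prop
  · intro c A
    simp only [T, Pi.smul_apply, smul_eq_mul, mul_smul, ← Finset.smul_sum, smul_mul_smul_comm, sq]
  -- Real squares summing to zero all vanish pointwise; linear independence of `β` then kills each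
  -- coefficient.
  · intro A hA
    have h1 : ∀ i, ∑ j, A i j • (β j : C(Y, ℝ)) = 0 := by
      intro i
      ext y
      have h2 := DFunLike.congr_fun hA y
      simp only [T, ContinuousMap.sum_apply, ContinuousMap.mul_apply, ContinuousMap.zero_apply]
        at h2
      rw [Finset.sum_eq_zero_iff_of_nonneg fun _ _ => mul_self_nonneg _] at h2
      have h3 := mul_self_eq_zero.1 (h2 i (Finset.mem_univ _))
      simpa using h3
    funext i j
    have h2 : ∑ j, A i j • β j = 0 := by
      apply Subtype.ext
      simpa using h1 i
    exact Fintype.linearIndependent_iff.1 β.linearIndependent _ h2 j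

end ClosedCone

/-! ### Restriction to the compact set X, and sums of squares there with degree bounds. -/

namespace SphereGMP

variable {σ ι κ : Type} [Fintype σ] [DecidableEq κ] (G : SphereGMP σ ι κ)

lemma isClosed_feasSet : IsClosed G.feasSet := by
  have : G.feasSet = ⋂ l, {x | eval x (G.spherePoly l) = 0} := by
    ext; simp [feasSet]
  rw [this]
  exact isClosed_iInter fun l => isClosed_eq (MvPolynomial.continuous_eval _) continuous_const

lemma isCompact_feasSet : IsCompact G.feasSet := by
  refine Metric.isCompact_of_isClosed_isBounded G.isClosed_feasSet ?_
  refine (Metric.isBounded_closedBall (x := (0 : σ → ℝ)) (r := 1)).subset fun x hx => ?_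
  rw [mem_closedBall_zero_iff, pi_norm_le_iff_of_nonneg zero_le_one]
  intro u
  have h1 := G.mem_feasSet_iff.1 hx (G.blk u)
  have h2 : x u ^ 2 ≤ ∑ v with G.blk v = G.blk u, x v ^ 2 :=
    Finset.single_le_sum (f := fun v => x v ^ 2) (fun _ _ => sq_nonneg _) (by simp)
  rw [Real.norm_eq_abs, ← sq_le_one_iff_abs_le_one]
  linarith

instance : CompactSpace G.feasSet := isCompact_iff_compactSpace.1 G.isCompact_feasSet

/-- Restriction of polynomials to the product of spheres. -/
noncomputable def restr : MvPolynomial σ ℝ →ₐ[ℝ] C(G.feasSet, ℝ) :=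
  aeval fun v => ⟨fun x => x.1 v, (continuous_apply v).comp continuous_subtype_val⟩

lemma restr_apply (p : MvPolynomial σ ℝ) (x : G.feasSet) : G.restr p x = eval x.1 p := by
  induction p using MvPolynomial.induction_on with
  | C a => simp [restr]
  | add p q hp hq => simp [hp, hq]
  | mul_X p v hp => simp [hp]; simp [restr]

/-- The cone of restrictions to the product of spheres of sums of squares of polynomials of
degree at most `t`. -/
noncomputable def sosCone (t : ℕ) : AddSubmonoid C(G.feasSet, ℝ) :=
  AddSubmonoid.closure {g | ∃ q : MvPolynomial σ ℝ, q.totalDegree ≤ t ∧ g = G.restr q * G.restr q}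

lemma isClosed_sosCone (t : ℕ) : IsClosed (G.sosCone t : Set C(G.feasSet, ℝ)) := by
  have := isClosed_closure_squares ((restrictTotalDegree σ ℝ t).map G.restr.toLinearMap)
  convert this using 2
  simp [sosCone, mem_restrictTotalDegree]

lemma sosCone_nonneg {t : ℕ} {g : C(G.feasSet, ℝ)} (hg : g ∈ G.sosCone t) (x : G.feasSet) :
    0 ≤ g x := by
  refine AddSubmonoid.closure_induction (motive := fun g _ => 0 ≤ g x) ?_ le_rfl ?_ hg
  · rintro _ ⟨q, -, rfl⟩
    exact mul_self_nonneg _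
  · intro a b _ _ ha hb
    exact add_nonneg ha hb

lemma smul_mem_sosCone {t : ℕ} {g : C(G.feasSet, ℝ)} (hg : g ∈ G.sosCone t) {c : ℝ}
    (hc : 0 ≤ c) : c • g ∈ G.sosCone t := by
  refine AddSubmonoid.closure_induction (motive := fun g _ => c • g ∈ G.sosCone t) ?_ ?_ ?_ hg
  · rintro _ ⟨q, hq, rfl⟩
    refine AddSubmonoid.subset_closure ⟨Real.sqrt c • q, (totalDegree_smul_le _ _).trans hq, ?_⟩
    rw [map_smul, smul_mul_smul_comm, Real.mul_self_sqrt hc]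
  · rw [smul_zero]; exact zero_mem _
  · intro a b _ _ ha hb
    rw [smul_add]; exact add_mem ha hb

lemma sq_mem_sosCone {t : ℕ} {q : MvPolynomial σ ℝ} (hq : q.totalDegree ≤ t) :
    G.restr q * G.restr q ∈ G.sosCone t :=
  AddSubmonoid.subset_closure ⟨q, hq, rfl⟩

lemma const_mem_sosCone (t : ℕ) {c : ℝ} (hc : 0 ≤ c) :
    (algebraMap ℝ C(G.feasSet, ℝ) c) ∈ G.sosCone t := by
  have := G.smul_mem_sosCone (G.sq_mem_sosCone (t := t) (q := 1) (by simp)) hc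
  simpa [Algebra.algebraMap_eq_smul_one] using this

/-- On the product of spheres, `1 - m²` is a sum of squares for every monomial `m`. -/
lemma one_sub_monomial_sq_mem_sosCone (t : ℕ) (m : σ →₀ ℕ) (hm : m.degree ≤ t) :
    1 - G.restr (monomial m 1) * G.restr (monomial m 1) ∈ G.sosCone t := by
  classical
  induction hd : m.degree generalizing m with
  | zero =>
    have : m = 0 := (Finsupp.degree_eq_zero_iff m).1 hd
    subst this
    have h1 : (monomial (0 : σ →₀ ℕ) (1 : ℝ)) = 1 := rfl
    rw [h1, map_one, mul_one, sub_self]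
    exact zero_mem _
  | succ d ih =>
    obtain ⟨v, hv⟩ : ∃ v, m v ≠ 0 := by
      by_contra! h
      have : m = 0 := Finsupp.ext h
      simp [this] at hd
    set m' : σ →₀ ℕ := m - Finsupp.single v 1 with hm'
    have hmm : m = m' + Finsupp.single v 1 := by
      rw [hm', tsub_add_cancel_of_le]
      rw [Finsupp.single_le_iff]; omega
    have hdeg : m.degree = m'.degree + 1 := by rw [hmm, map_add, Finsupp.degree_single]
    have hX : ∀ u : σ, monomial (m' + Finsupp.single u 1) (1 : ℝ) = monomial m' 1 * X u := by
      intro u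
      rw [X, monomial_mul, one_mul]
    -- With m = m' x_v: 1 - m² = (1 - m'²) + m'²(1 - x_v²), and on X the factor 1 - x_v² is the sum
    -- of the other squares in the block of v.
    have key : 1 - G.restr (monomial m 1) * G.restr (monomial m 1)
        = (1 - G.restr (monomial m' 1) * G.restr (monomial m' 1))
          + ∑ u ∈ ({u | G.blk u = G.blk v} : Finset σ).erase v,
            G.restr (monomial (m' + Finsupp.single u 1) 1)
              * G.restr (monomial (m' + Finsupp.single u 1) 1) := by
      ext x
      have hx := G.mem_feasSet_iff.1 x.2 (G.blk v)
      have hmem : v ∈ ({u | G.blk u = G.blk v} : Finset σ) := by simp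
      rw [← Finset.add_sum_erase _ _ hmem] at hx
      rw [hmm]
      simp only [hX, ContinuousMap.add_apply, ContinuousMap.sub_apply, ContinuousMap.mul_apply,
        ContinuousMap.one_apply, ContinuousMap.sum_apply, restr_apply, map_mul, eval_X]
      have : ∑ u ∈ ({u | G.blk u = G.blk v} : Finset σ).erase v,
          (eval x.1 (monomial m' 1) * x.1 u) * (eval x.1 (monomial m' 1) * x.1 u)
          = eval x.1 (monomial m' 1) ^ 2
            * ∑ u ∈ ({u | G.blk u = G.blk v} : Finset σ).erase v, x.1 u ^ 2 := by
        rw [Finset.mul_sum]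
        exact Finset.sum_congr rfl fun _ _ => by ring
      rw [this, eq_sub_of_add_eq' hx]
      ring
    rw [key]
    refine add_mem (ih m' (by omega) (by omega)) (sum_mem fun u _ => G.sq_mem_sosCone ?_)
    have : (m' + Finsupp.single u 1).degree ≤ t := by
      rw [map_add, Finsupp.degree_single]
      omega
    exact (totalDegree_monomial_le _ _).trans this

/-- A term a m₁m₂ with both factors of degree at most t satisfies, for a ≠ 0, |a| + a m₁m₂ =
(|a|/2)((1 - m₁²) + (1 - m₂²) + (m₁ + sign(a) m₂)²). The constants add up over the terms of `p`. -/
lemma exists_const_add_mem_sosCone {t : ℕ} {p : MvPolynomial σ ℝ} (hp : p.totalDegree ≤ 2 * t) :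
    ∃ c : ℝ, G.restr p + algebraMap ℝ _ c ∈ G.sosCone t := by
  classical
  have hsplit : ∀ (m : σ →₀ ℕ) (k : ℕ), k ≤ m.degree → ∃ m₁ ≤ m, m₁.degree = k := by
    intro m k
    induction k with
    | zero => exact fun _ => ⟨0, zero_le, by simp⟩
    | succ k ih =>
      intro hk
      obtain ⟨m₁, hle, hdeg⟩ := ih (by omega)
      obtain ⟨v, hv⟩ : ∃ v, m₁ v < m v := by
        by_contra! h
        have : m₁ = m := le_antisymm hle h
        rw [this] at hdeg
        omega
      refine ⟨m₁ + Finsupp.single v 1, fun u => ?_, by rw [map_add, Finsupp.degree_single, hdeg]⟩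
      rw [Finsupp.add_apply, Finsupp.single_apply]
      split_ifs with h
      · subst h; exact hv
      · exact hle u
  have hmono : ∀ (m : σ →₀ ℕ) (a : ℝ), m.degree ≤ 2 * t →
      ∃ c : ℝ, G.restr (monomial m a) + algebraMap ℝ _ c ∈ G.sosCone t := by
    intro m a hm
    obtain ⟨m₁, hle, hdeg⟩ := hsplit m (min t m.degree) (min_le_right _ _)
    obtain ⟨m₂, rfl⟩ := exists_add_of_le hle
    rw [map_add] at hdeg hm
    have h1 : m₁.degree ≤ t := by omega
    have h2 : m₂.degree ≤ t := by omega
    have hm1 := G.one_sub_monomial_sq_mem_sosCone t m₁ h1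
    have hm2 := G.one_sub_monomial_sq_mem_sosCone t m₂ h2
    have hq := G.sq_mem_sosCone (t := t) (q := monomial m₁ 1 + (SignType.sign a : ℝ) • monomial m₂ 1)
      ((totalDegree_add _ _).trans (max_le ((totalDegree_monomial_le _ _).trans h1)
        ((totalDegree_smul_le _ _).trans ((totalDegree_monomial_le _ _).trans h2))))
    have hsig : (SignType.sign a : ℝ) ^ 2 ≤ 1 := by
      rcases SignType.sign a with _ | _ | _ <;> norm_num
    refine ⟨|a|, ?_⟩
    have hr : G.restr (monomial (m₁ + m₂) a) = a • (G.restr (monomial m₁ 1)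
        * G.restr (monomial m₂ 1)) := by
      rw [← map_mul, ← map_smul, monomial_mul, smul_monomial]
      simp
    -- The powers of the sign and the last constant make the identity uniform, including a = 0,
    -- where the sign is 0.
    have key : G.restr (monomial (m₁ + m₂) a) + algebraMap ℝ _ |a|
        = (|a| / 2) • ((1 - G.restr (monomial m₁ 1) * G.restr (monomial m₁ 1))
          + (SignType.sign a : ℝ) ^ 2 • (1 - G.restr (monomial m₂ 1) * G.restr (monomial m₂ 1))
          + G.restr (monomial m₁ 1 + (SignType.sign a : ℝ) • monomial m₂ 1)
            * G.restr (monomial m₁ 1 + (SignType.sign a : ℝ) • monomial m₂ 1)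
          + algebraMap ℝ _ (1 - (SignType.sign a : ℝ) ^ 2)) := by
      rw [hr]
      ext x
      simp only [map_add, map_smul, ContinuousMap.add_apply, ContinuousMap.sub_apply,
        ContinuousMap.mul_apply, ContinuousMap.one_apply, ContinuousMap.smul_apply, smul_eq_mul,
        Algebra.algebraMap_eq_smul_one, mul_one]
      have h3 : |a| * (SignType.sign a : ℝ) = a := abs_mul_sign a
      linear_combination (-(G.restr (monomial m₁ 1) x) * (G.restr (monomial m₂ 1) x)) * h3
    rw [key]
    exact G.smul_mem_sosCone (add_mem (add_mem (add_mem hm1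
      (G.smul_mem_sosCone hm2 (sq_nonneg _))) hq)
      (G.const_mem_sosCone t (by linarith))) (by positivity)
  have hsum : ∀ s : Finset (σ →₀ ℕ), (∀ m ∈ s, m.degree ≤ 2 * t) → ∃ c : ℝ,
      G.restr (∑ m ∈ s, monomial m (coeff m p)) + algebraMap ℝ _ c ∈ G.sosCone t := by
    intro s
    induction s using Finset.induction_on with
    | empty => exact fun _ => ⟨0, by simp⟩
    | insert m s hms ih =>
      intro h
      obtain ⟨c₁, hc₁⟩ := ih fun k hk => h k (Finset.mem_insert_of_mem hk)
      obtain ⟨c₂, hc₂⟩ := hmono m (coeff m p) (h m (Finset.mem_insert_self _ _))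
      refine ⟨c₂ + c₁, ?_⟩
      rw [Finset.sum_insert hms, map_add, map_add, add_add_add_comm]
      exact add_mem hc₂ hc₁
  rw [p.as_sum]
  exact hsum _ fun m hm => (le_totalDegree hm).trans hp

end SphereGMP

/-! ### Relative interiors and orthogonal projection. -/

/-- A point of the relative interior of a set containing the origin stays in the set after a small
step in the direction opposite to any element of the set. -/
lemma exists_pos_sub_smul_mem_of_mem_intrinsicInterior {E : Type} [AddCommGroup E] [Module ℝ E]
    [TopologicalSpace E] [IsTopologicalAddGroup E] [ContinuousSMul ℝ E] {s : Set E} {b c : E}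
    (h0 : (0 : E) ∈ s) (hb : b ∈ intrinsicInterior ℝ s) (hc : c ∈ s) :
    ∃ ε : ℝ, 0 < ε ∧ b - ε • c ∈ s := by
  obtain ⟨y, hy, rfl⟩ := mem_intrinsicInterior.1 hb
  -- Since 0 lies in `s`, `c` is a direction of the affine span, so the line `y - ε • c` never
  -- leaves it and relative openness applies.
  have hdir : c ∈ (affineSpan ℝ s).direction := by
    have := AffineSubspace.vsub_mem_direction (subset_affineSpan ℝ s hc)
      (subset_affineSpan ℝ s h0)
    simpa using this
  have hmem : ∀ ε : ℝ, (y : E) - ε • c ∈ affineSpan ℝ s := by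
    intro ε
    have := AffineSubspace.vadd_mem_of_mem_direction
      ((affineSpan ℝ s).direction.smul_mem (-ε) hdir) y.2
    rw [vadd_eq_add, neg_smul, neg_add_eq_sub] at this
    exact this
  let γ : ℝ → affineSpan ℝ s := fun ε => ⟨y - ε • c, hmem ε⟩
  have hγ : Continuous γ := by
    refine Continuous.subtype_mk ?_ _
    fun_prop
  have hγ0 : γ 0 = y := Subtype.ext (by simp [γ])
  have hnhds : γ ⁻¹' interior (Subtype.val ⁻¹' s) ∈ nhds (0 : ℝ) :=
    hγ.continuousAt.preimage_mem_nhds (by rw [hγ0]; exact isOpen_interior.mem_nhds hy)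
  obtain ⟨δ, hδ, hball⟩ := Metric.mem_nhds_iff.1 hnhds
  refine ⟨δ / 2, by positivity, ?_⟩
  have : δ / 2 ∈ Metric.ball (0 : ℝ) δ := by
    rw [mem_ball_zero_iff, Real.norm_eq_abs, abs_of_pos (by positivity)]
    linarith
  have h : γ (δ / 2) ∈ Subtype.val ⁻¹' s := interior_subset (hball this)
  exact h

/-- The orthogonal projection onto a subspace of `ι → ℝ` with respect to the dot product. -/
lemma exists_dotProduct_projection {ι : Type} [Fintype ι] (S : Submodule ℝ (ι → ℝ)) :
    ∃ P : (ι → ℝ) → (ι → ℝ), ∀ a, P a ∈ S ∧ ∀ s ∈ S, s ⬝ᵥ (a - P a) = 0 := by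
  let e := WithLp.linearEquiv 2 ℝ (ι → ℝ)
  let S' : Submodule ℝ (EuclideanSpace ℝ ι) := S.comap e.toLinearMap
  refine ⟨fun a => e (S'.starProjection (e.symm a)), fun a => ⟨?_, fun s hs => ?_⟩⟩
  · exact S'.starProjection_apply_mem (e.symm a)
  · have h1 : e.symm s ∈ S' := by simpa [S'] using hs
    have h2 := S'.sub_starProjection_mem_orthogonal (e.symm a)
    have h3 := (Submodule.mem_orthogonal' _ _).1 h2 _ h1
    rw [EuclideanSpace.inner_eq_star_dotProduct] at h3
    simpa [e] using h3

/-! ### Moment cones, strict feasibility and dual attainment. -/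

namespace SphereGMP

variable {σ ι κ : Type} (G : SphereGMP σ ι κ)

/-- The vector of values of the constraint polynomials at a point. -/
noncomputable def momentVec (x : σ → ℝ) : ι → ℝ := fun i => eval x (G.h i)

lemma eval_dualPoly [Fintype ι] (lam : ι → ℝ) (x : σ → ℝ) :
    eval x (G.dualPoly lam) = eval x G.f - G.momentVec x ⬝ᵥ lam := by
  simp [dualPoly, momentVec, dotProduct, mul_comm]

lemma dualObj_eq_dotProduct [Fintype ι] (lam : ι → ℝ) : G.dualObj lam = G.b ⬝ᵥ lam := rfl

variable [Fintype σ] [DecidableEq κ]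

section MomentCone

lemma integrable_eval {μ : Measure (σ → ℝ)} [IsFiniteMeasure μ] (hμ : μ G.feasSetᶜ = 0)
    (p : MvPolynomial σ ℝ) : Integrable (fun x => eval x p) μ := by
  obtain ⟨M, hM⟩ := G.isCompact_feasSet.exists_bound_of_continuousOn
    (MvPolynomial.continuous_eval p).continuousOn
  refine Integrable.of_bound (MvPolynomial.continuous_eval p).aestronglyMeasurable M ?_
  have : ∀ᵐ x ∂μ, x ∈ G.feasSet := hμ
  filter_upwards [this] with x hx using hM x hx

lemma zero_mem_momentCone : (0 : ι → ℝ) ∈ G.momentCone :=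
  ⟨0, inferInstance, by simp, by simp⟩

variable {G}

lemma add_mem_momentCone {c d : ι → ℝ} (hc : c ∈ G.momentCone) (hd : d ∈ G.momentCone) :
    c + d ∈ G.momentCone := by
  obtain ⟨μ, hμ, hμX, hμc⟩ := hc
  obtain ⟨ν, hν, hνX, hνd⟩ := hd
  refine ⟨μ + ν, inferInstance, by simp [hμX, hνX], fun i => ?_⟩
  rw [integral_add_measure (G.integrable_eval hμX _) (G.integrable_eval hνX _), Pi.add_apply,
    hμc, hνd]

lemma smul_mem_momentCone {c : ι → ℝ} (hc : c ∈ G.momentCone) {w : ℝ} (hw : 0 ≤ w) :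
    w • c ∈ G.momentCone := by
  obtain ⟨μ, hμ, hμX, hμc⟩ := hc
  refine ⟨w.toNNReal • μ, inferInstance, by simp [hμX], fun i => ?_⟩
  rw [integral_smul_nnreal_measure, Pi.smul_apply, hμc, NNReal.smul_def, Real.coe_toNNReal _ hw]

lemma sum_mem_momentCone {α : Type} {s : Finset α} {c : α → ι → ℝ}
    (hc : ∀ a ∈ s, c a ∈ G.momentCone) : ∑ a ∈ s, c a ∈ G.momentCone := by
  classical
  induction s using Finset.induction_on with
  | empty => simpa using G.zero_mem_momentCone
  | insert a s ha ih =>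
    rw [Finset.sum_insert ha]
    exact add_mem_momentCone (hc a (Finset.mem_insert_self _ _))
      (ih fun b hb => hc b (Finset.mem_insert_of_mem hb))

lemma momentVec_mem_momentCone {x : σ → ℝ} (hx : x ∈ G.feasSet) :
    G.momentVec x ∈ G.momentCone := by
  refine ⟨Measure.dirac x, inferInstance, ?_, fun i => ?_⟩
  · rw [Measure.dirac_apply' _ G.isClosed_feasSet.measurableSet.compl]
    simp [hx]
  · rw [integral_dirac]
    rfl

variable (G)

/-- The right hand side is in the moment cone, and stays there after a small step against any
moment vector of a point. -/
def StrictlyFeasible : Prop :=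
  G.b ∈ G.momentCone ∧ ∀ x ∈ G.feasSet, ∃ ε : ℝ, 0 < ε ∧ G.b - ε • G.momentVec x ∈ G.momentCone

variable {G} in
lemma RelintAssumption.strictlyFeasible (h : G.RelintAssumption) : G.StrictlyFeasible :=
  ⟨intrinsicInterior_subset h, fun _ hx => exists_pos_sub_smul_mem_of_mem_intrinsicInterior
    G.zero_mem_momentCone h (momentVec_mem_momentCone hx)⟩

end MomentCone

section Attainment

/-- Makes the feasible set of the strengthening the preimage of a closed cone. For the converse,
lift the squares to a polynomial s: then p - s vanishes on X with degree at most 2t, hence lies in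
the truncated ideal. Surjectivity of `blk` supplies a variable to eliminate in each block. -/
lemma exists_sos_add_truncIdeal_iff [Fintype κ] (hblk : Function.Surjective G.blk) {t : ℕ}
    {p : MvPolynomial σ ℝ} (hp : p.totalDegree ≤ 2 * t) :
    (∃ s q : MvPolynomial σ ℝ, IsSumSq s ∧ s.totalDegree ≤ 2 * t ∧
      q ∈ G.truncIdeal (2 * t) ∧ p = s + q) ↔ G.restr p ∈ G.sosCone t := by
  constructor
  · rintro ⟨s, q, hs, hst, hq, rfl⟩
    have h1 : G.restr (s + q) = G.restr s := by
      ext x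
      rw [restr_apply, restr_apply, map_add, G.eval_eq_zero_of_mem_truncIdeal hq x.2, add_zero]
    rw [h1]
    refine AddSubmonoid.closure_induction (motive := fun s _ => G.restr s ∈ G.sosCone t)
      ?_ ?_ ?_ (hs.mem_closure_of_totalDegree_le hst)
    · rintro _ ⟨q, hq, rfl⟩
      rw [map_mul]
      exact G.sq_mem_sosCone hq
    · rw [map_zero]; exact zero_mem _
    · intro a b _ _ ha hb
      rw [map_add]; exact add_mem ha hb
  · intro h
    have h1 : ∃ s : MvPolynomial σ ℝ, IsSumSq s ∧ s.totalDegree ≤ 2 * t ∧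
        G.restr p = G.restr s := by
      refine AddSubmonoid.closure_induction (motive := fun g _ => ∃ s : MvPolynomial σ ℝ,
        IsSumSq s ∧ s.totalDegree ≤ 2 * t ∧ g = G.restr s) ?_ ?_ ?_ h
      · rintro _ ⟨q, hq, rfl⟩
        refine ⟨q * q, IsSumSq.mul_self q, (totalDegree_mul _ _).trans (by omega), ?_⟩
        rw [map_mul]
      · exact ⟨0, IsSumSq.zero, by simp, by simp⟩
      · rintro _ _ _ _ ⟨s, hs, hst, rfl⟩ ⟨s', hs', hst', rfl⟩
        exact ⟨s + s', hs.add hs', (totalDegree_add _ _).trans (max_le hst hst'), by simp⟩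
    obtain ⟨s, hs, hst, heq⟩ := h1
    refine ⟨s, p - s, hs, hst, ?_, by ring⟩
    refine mem_truncIdeal_of_vanishing (Function.surjInv_eq hblk)
      ((totalDegree_sub _ _).trans (max_le hp hst)) fun x hx => ?_
    have := DFunLike.congr_fun heq ⟨x, hx⟩
    rw [restr_apply, restr_apply] at this
    rw [map_sub, this, sub_self]

variable [Fintype ι]

lemma dotProduct_eq_integral {c : ι → ℝ} {μ : Measure (σ → ℝ)} [IsFiniteMeasure μ]
    (hμ : μ G.feasSetᶜ = 0) (hc : ∀ i, c i = ∫ x, eval x (G.h i) ∂μ) (lam : ι → ℝ) :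
    c ⬝ᵥ lam = ∫ x, G.momentVec x ⬝ᵥ lam ∂μ := by
  simp only [dotProduct, momentVec]
  rw [integral_finsetSum _ fun i _ => (G.integrable_eval hμ _).mul_const _]
  exact Finset.sum_congr rfl fun i _ => by rw [integral_mul_const, hc]

/-- Weak duality. -/
lemma exists_dotProduct_le {c : ι → ℝ} (hc : c ∈ G.momentCone) :
    ∃ M : ℝ, ∀ lam : ι → ℝ, (∀ x ∈ G.feasSet, 0 ≤ eval x (G.dualPoly lam)) → c ⬝ᵥ lam ≤ M := by
  obtain ⟨μ, hμ, hμX, hμc⟩ := hc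
  refine ⟨∫ x, eval x G.f ∂μ, fun lam hlam => ?_⟩
  rw [G.dotProduct_eq_integral hμX hμc]
  refine integral_mono_ae ?_ (G.integrable_eval hμX _) ?_
  · simp only [dotProduct, momentVec]
    exact integrable_finsetSum _ fun i _ => (G.integrable_eval hμX _).mul_const _
  · have : ∀ᵐ x ∂μ, x ∈ G.feasSet := hμX
    filter_upwards [this] with x hx
    have := hlam x hx
    rw [eval_dualPoly] at this
    linarith

/-- A point of the moment cone is an integral of moment vectors, so it inherits their orthogonality
relations. This is why projecting λ preserves the objective. -/
lemma dotProduct_eq_zero_of_orthogonal {c w : ι → ℝ} (hc : c ∈ G.momentCone)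
    (hw : ∀ x ∈ G.feasSet, G.momentVec x ⬝ᵥ w = 0) : c ⬝ᵥ w = 0 := by
  obtain ⟨μ, hμ, hμX, hμc⟩ := hc
  rw [G.dotProduct_eq_integral hμX hμc]
  refine integral_eq_zero_of_ae ?_
  have : ∀ᵐ x ∂μ, x ∈ G.feasSet := hμX
  filter_upwards [this] with x hx using hw x hx

/-- Strict feasibility implies attainment for the conic dual problem given by any closed set of
nonnegative functions on the product of spheres. -/
theorem StrictlyFeasible.supAttained_of_isClosed (hG : G.StrictlyFeasible)
    {K : Set C(G.feasSet, ℝ)} (hK : IsClosed K) (hK0 : ∀ g ∈ K, ∀ x, 0 ≤ g x)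
    (hne : ∃ lam, G.restr (G.dualPoly lam) ∈ K) :
    SupAttained {lam : ι → ℝ | G.restr (G.dualPoly lam) ∈ K} G.dualObj := by
  classical
  obtain ⟨hbK, hstep⟩ := hG
  obtain ⟨lam₀, h₀⟩ := hne
  have hfeas : ∀ lam, G.restr (G.dualPoly lam) ∈ K →
      ∀ x ∈ G.feasSet, 0 ≤ eval x (G.dualPoly lam) := by
    intro lam h x hx
    have := hK0 _ h ⟨x, hx⟩
    rwa [restr_apply] at this
  let S : Submodule ℝ (ι → ℝ) := Submodule.span ℝ (G.momentVec '' G.feasSet)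
  have hS : ∀ x ∈ G.feasSet, G.momentVec x ∈ S := fun x hx =>
    Submodule.subset_span ⟨x, hx, rfl⟩
  have hbd : ∀ s ∈ S, ∃ c : ℝ, ∀ lam, G.restr (G.dualPoly lam) ∈ K →
      G.dualObj lam₀ ≤ G.dualObj lam → |s ⬝ᵥ lam| ≤ c := by
    intro s hs
    induction hs using Submodule.span_induction with
    | mem s hs =>
      obtain ⟨x, hx, rfl⟩ := hs
      obtain ⟨ε, hε, hmem⟩ := hstep x hx
      obtain ⟨M, hM⟩ := G.exists_dotProduct_le hmem
      -- The first bound is feasibility at `x`. The second bounds the negative: weak duality for b -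
      -- ε h(x) gives b·λ - ε h(x)·λ ≤ M, and b·λ is at least its value at `lam₀`.
      refine ⟨max (eval x G.f) ((M - G.dualObj lam₀) / ε), fun lam h hle => abs_le'.2 ⟨?_, ?_⟩⟩
      · have := hfeas lam h x hx
        rw [eval_dualPoly] at this
        exact le_max_of_le_left (by linarith)
      · have := hM lam (hfeas lam h)
        rw [sub_dotProduct, smul_dotProduct, ← dualObj_eq_dotProduct, smul_eq_mul] at this
        refine le_max_of_le_right ?_
        rw [le_div_iff₀ hε]
        linarith
    | zero => exact ⟨0, by simp⟩
    | add s s' _ _ ih ih' =>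
      obtain ⟨c, hc⟩ := ih
      obtain ⟨c', hc'⟩ := ih'
      refine ⟨c + c', fun lam h hle => ?_⟩
      rw [add_dotProduct]
      exact (abs_add_le _ _).trans (add_le_add (hc lam h hle) (hc' lam h hle))
    | smul a s _ ih =>
      obtain ⟨c, hc⟩ := ih
      refine ⟨|a| * c, fun lam h hle => ?_⟩
      rw [smul_dotProduct, smul_eq_mul, abs_mul]
      exact mul_le_mul_of_nonneg_left (hc lam h hle) (abs_nonneg _)
  obtain ⟨P, hP⟩ := exists_dotProduct_projection S
  have hPobj : ∀ lam, G.dualObj (P lam) = G.dualObj lam := by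
    intro lam
    have := G.dotProduct_eq_zero_of_orthogonal hbK (w := lam - P lam)
      fun x hx => (hP lam).2 _ (hS x hx)
    rw [dotProduct_sub] at this
    exact (sub_eq_zero.1 this).symm
  have hPmem : ∀ lam, G.restr (G.dualPoly (P lam)) = G.restr (G.dualPoly lam) := by
    intro lam
    ext x
    have := (hP lam).2 _ (hS x x.2)
    rw [dotProduct_sub] at this
    rw [restr_apply, restr_apply, eval_dualPoly, eval_dualPoly, sub_eq_zero.1 this]
  -- Self-adjointness of the projection writes each coordinate of `P lam` as a pairing of `lam` with
  -- an element of `S`, so `hbd` confines `P lam` to a box.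
  have hPcoord : ∀ lam i, P lam i = P (Pi.single i 1) ⬝ᵥ lam := by
    intro lam i
    have h1 := (hP lam).2 _ (hP (Pi.single i 1)).1
    have h2 := (hP (Pi.single i 1)).2 _ (hP lam).1
    rw [dotProduct_sub, sub_eq_zero] at h1 h2
    rw [h1, dotProduct_comm, ← h2, dotProduct_single, mul_one]
  choose c hc using fun i => hbd _ (hP (Pi.single i 1)).1
  let Q : Set (ι → ℝ) := {lam | G.restr (G.dualPoly lam) ∈ K ∧ G.dualObj lam₀ ≤ G.dualObj lam} ∩
    Set.univ.pi fun i => Set.Icc (-c i) (c i)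
  have hobj : Continuous G.dualObj := by
    unfold dualObj
    fun_prop
  have hcont : Continuous fun lam => G.restr (G.dualPoly lam) := by
    have : (fun lam => G.restr (G.dualPoly lam))
        = fun lam => G.restr G.f - ∑ i, lam i • G.restr (G.h i) := by
      funext lam
      simp [dualPoly, C_mul']
    rw [this]
    fun_prop
  have hQ : IsCompact Q := by
    refine IsCompact.inter_left (isCompact_univ_pi fun i => isCompact_Icc) ?_
    exact (hK.preimage hcont).inter (isClosed_le continuous_const hobj)
  have hPQ : ∀ lam, G.restr (G.dualPoly lam) ∈ K → G.dualObj lam₀ ≤ G.dualObj lam →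
      P lam ∈ Q := by
    intro lam h hle
    refine ⟨⟨by rwa [hPmem], by rwa [hPobj]⟩, fun i _ => ?_⟩
    rw [hPcoord]
    exact abs_le.1 (hc i lam h hle)
  obtain ⟨lam₁, h₁, hmax⟩ := hQ.exists_isMaxOn ⟨_, hPQ lam₀ h₀ le_rfl⟩ hobj.continuousOn
  refine ⟨lam₁, h₁.1.1, fun lam h => ?_⟩
  rcases le_total (G.dualObj lam₀) (G.dualObj lam) with hle | hle
  · have := hmax (hPQ lam h hle)
    rw [Set.mem_ofPred_eq, hPobj] at this
    exact this
  · exact hle.trans h₁.1.2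

/-- A multiplier whose combination of the h_i is 1 on X can add any constant to f, in particular one
making it a sum of squares. -/
lemma exists_restr_dualPoly_mem_sosCone
    (hone : ∃ lam, ∀ x ∈ G.feasSet, G.momentVec x ⬝ᵥ lam = 1) {t : ℕ}
    (ht : G.f.totalDegree ≤ 2 * t) : ∃ lam, G.restr (G.dualPoly lam) ∈ G.sosCone t := by
  obtain ⟨lam, hlam⟩ := hone
  obtain ⟨c, hc⟩ := G.exists_const_add_mem_sosCone ht
  refine ⟨(-c) • lam, ?_⟩
  convert hc using 1
  ext x
  rw [restr_apply, eval_dualPoly, dotProduct_smul, hlam x x.2, ContinuousMap.add_apply,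
    restr_apply, Algebra.algebraMap_eq_smul_one, ContinuousMap.smul_apply]
  simp

variable [Fintype κ]

lemma totalDegree_le_of_tMin_le {t : ℕ} (ht : G.tMin ≤ t) :
    G.f.totalDegree ≤ 2 * t ∧ ∀ lam, (G.dualPoly lam).totalDegree ≤ 2 * t := by
  have h1 : (G.f.totalDegree + 1) / 2 ≤ t := (le_max_left _ _).trans ht
  have h2 : ∀ i, ((G.h i).totalDegree + 1) / 2 ≤ t := fun i =>
    (Finset.le_sup (f := fun i => ((G.h i).totalDegree + 1) / 2) (Finset.mem_univ i)).trans
      ((le_max_left _ _).trans ((le_max_right _ _).trans ht))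
  refine ⟨by omega, fun lam => ?_⟩
  refine (totalDegree_sub _ _).trans (max_le (by omega) (totalDegree_finsetSum_le fun i _ => ?_))
  rw [C_mul']
  refine (totalDegree_smul_le _ _).trans ?_
  have := h2 i
  omega

/-- Strict feasibility implies duality attainment for the problem and its relaxations, provided
that the constant one is a combination of the constraint polynomials on the feasible set. -/
theorem StrictlyFeasible.dualityAttainment (hG : G.StrictlyFeasible)
    (hblk : Function.Surjective G.blk)
    (hone : ∃ lam, ∀ x ∈ G.feasSet, G.momentVec x ⬝ᵥ lam = 1) :
    G.DualityAttainment ∧ ∀ t : ℕ, G.tMin ≤ t → G.RelaxDualityAttainment t := by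
  constructor
  · have hclosed : IsClosed {g : C(G.feasSet, ℝ) | ∀ x, 0 ≤ g x} := by
      have : {g : C(G.feasSet, ℝ) | ∀ x, 0 ≤ g x} = ⋂ x, {g | 0 ≤ g x} := by
        ext; simp
      rw [this]
      exact isClosed_iInter fun x => isClosed_le continuous_const (by fun_prop)
    -- Sums of squares are nonnegative, so a point feasible at a sufficiently high order is feasible
    -- for the dual itself.
    obtain ⟨lam, hlam⟩ := G.exists_restr_dualPoly_mem_sosCone hone (t := G.f.totalDegree) (by omega)
    have := hG.supAttained_of_isClosed G hclosed (fun g hg => hg)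
      ⟨lam, G.sosCone_nonneg hlam⟩
    unfold DualityAttainment
    convert this using 2
    ext lam
    simp [restr_apply]
  · intro t ht
    obtain ⟨hf, hd⟩ := G.totalDegree_le_of_tMin_le ht
    have := hG.supAttained_of_isClosed G (G.isClosed_sosCone t) (fun g hg => G.sosCone_nonneg hg)
      (G.exists_restr_dualPoly_mem_sosCone hone hf)
    unfold RelaxDualityAttainment
    convert this using 2
    ext lam
    exact G.exists_sos_add_truncIdeal_iff hblk (hd lam)

end Attainment

end SphereGMP

/-! ### Passing from complex to real variables. -/

section Realification

variable {V : Type}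

/-- The complex vector with the given real and imaginary parts. -/
def complexPoint (x : V ⊕ V → ℝ) : V → ℂ := fun v => ⟨x (Sum.inl v), x (Sum.inr v)⟩

/-- The vector of real and imaginary parts of a complex vector. -/
def realPoint (z : V → ℂ) : V ⊕ V → ℝ := Sum.elim (fun v => (z v).re) (fun v => (z v).im)

/-- The value of a polynomial in complex variables and their conjugates. -/
noncomputable def evalConj (z : V → ℂ) : MvPolynomial (V ⊕ V) ℂ →+* ℂ :=
  eval (Sum.elim z fun v => (starRingEnd ℂ) (z v))

lemma eval_changeVars (x : V ⊕ V → ℝ) (p : MvPolynomial (V ⊕ V) ℂ) :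
    eval (fun u => (x u : ℂ)) (changeVars p) = evalConj (complexPoint x) p := by
  unfold changeVars evalConj
  rw [← aeval_eq_eval, ← aeval_eq_eval]
  change aeval _ (bind₁ _ p) = _
  rw [aeval_bind₁]
  congr 2
  funext u
  rcases u with v | v
  · simp only [Sum.elim_inl, map_add, map_mul, aeval_X, aeval_C, complexPoint]
    apply Complex.ext <;> simp
  · simp only [Sum.elim_inr, map_sub, map_mul, aeval_X, aeval_C, complexPoint]
    apply Complex.ext <;> simp

lemma eval_polyRe (x : V ⊕ V → ℝ) (p : MvPolynomial (V ⊕ V) ℂ) :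
    eval x (polyRe p) = (evalConj (complexPoint x) p).re := by
  rw [← eval_changeVars, MvPolynomial.eval_eq _ (changeVars p), Complex.re_sum, polyRe, map_sum]
  refine Finset.sum_congr rfl fun m _ => ?_
  rw [eval_monomial, Finsupp.prod]
  simp only [← Complex.ofReal_pow, ← Complex.ofReal_prod, Complex.re_mul_ofReal]

lemma eval_polyIm (x : V ⊕ V → ℝ) (p : MvPolynomial (V ⊕ V) ℂ) :
    eval x (polyIm p) = (evalConj (complexPoint x) p).im := by
  rw [← eval_changeVars, MvPolynomial.eval_eq _ (changeVars p), Complex.im_sum, polyIm, map_sum]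
  refine Finset.sum_congr rfl fun m _ => ?_
  rw [eval_monomial, Finsupp.prod]
  simp only [← Complex.ofReal_pow, ← Complex.ofReal_prod, Complex.im_mul_ofReal]

variable {ι κ : Type} {blk : V → κ} {f : MvPolynomial (V ⊕ V) ℂ} {h : ι → MvPolynomial (V ⊕ V) ℂ}
  {b : ι → ℂ}

lemma momentVec_realifyGMP (x : V ⊕ V → ℝ) :
    (realifyGMP blk f h b).momentVec x = Sum.elim (fun i => (evalConj (complexPoint x) (h i)).re)
      (fun i => (evalConj (complexPoint x) (h i)).im) := by
  funext i
  rcases i with i | i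
  · exact eval_polyRe x (h i)
  · exact eval_polyIm x (h i)

/-- Conjugate polynomials have conjugate moments. Hence membership of b in K already forces ρ, τ and
ω to be Hermitian. -/
lemma eq_conj_of_mem_momentCone_realifyGMP [Fintype V] [DecidableEq κ]
    (hb : (realifyGMP blk f h b).b ∈ (realifyGMP blk f h b).momentCone) {i j : ι}
    (hij : ∀ z, evalConj z (h j) = (starRingEnd ℂ) (evalConj z (h i))) :
    b j = (starRingEnd ℂ) (b i) := by
  obtain ⟨μ, hμ, -, hc⟩ := hb
  have hval : ∀ k x, eval x ((realifyGMP blk f h b).h k)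
      = (realifyGMP blk f h b).momentVec x k := fun _ _ => rfl
  simp only [hval, momentVec_realifyGMP] at hc
  have hre : ∀ k, (b k).re = ∫ x, (evalConj (complexPoint x) (h k)).re ∂μ :=
    fun k => hc (Sum.inl k)
  have him : ∀ k, (b k).im = ∫ x, (evalConj (complexPoint x) (h k)).im ∂μ :=
    fun k => hc (Sum.inr k)
  apply Complex.ext
  · rw [Complex.conj_re, hre, hre]
    simp only [hij, Complex.conj_re]
  · rw [Complex.conj_im, him, him, ← integral_neg]
    simp only [hij, Complex.conj_im]

end Realification

/-! ### Real multipliers as complex matrices, and Hermitian parts. -/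

section Hermitian

variable {m : Type}

/-- The vector of real and imaginary parts of the entries of a complex matrix. -/
def matVec : Matrix m m ℂ →ₗ[ℝ] ((m × m) ⊕ (m × m) → ℝ) where
  toFun M := Sum.elim (fun p => (M p.1 p.2).re) (fun p => (M p.1 p.2).im)
  map_add' M N := by
    funext i; rcases i with i | i <;> simp
  map_smul' c M := by
    funext i; rcases i with i | i <;> simp

lemma matVec_surjective : Function.Surjective (matVec (m := m)) := by
  intro lam
  refine ⟨Matrix.of fun i j => ⟨lam (Sum.inl (i, j)), lam (Sum.inr (i, j))⟩, ?_⟩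
  funext i
  rcases i with i | i <;> rfl

/-- The Hermitian part of a matrix. -/
noncomputable def hermPart (L : Matrix m m ℂ) : Matrix m m ℂ := (1 / 2 : ℝ) • (L + L.conjTranspose)

lemma isHermitian_hermPart (L : Matrix m m ℂ) : (hermPart L).IsHermitian := by
  unfold hermPart Matrix.IsHermitian
  rw [Matrix.conjTranspose_smul, Matrix.conjTranspose_add, Matrix.conjTranspose_conjTranspose,
    add_comm, star_trivial]

lemma isHermitian_vecMulVec_star (v : m → ℂ) : (Matrix.vecMulVec v (star v)).IsHermitian := by
  unfold Matrix.IsHermitian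
  rw [Matrix.conjTranspose_vecMulVec, star_star]

variable [Fintype m]

lemma matVec_dotProduct (A B : Matrix m m ℂ) :
    matVec A ⬝ᵥ matVec B = (A * B.conjTranspose).trace.re := by
  simp only [dotProduct, matVec, LinearMap.coe_mk, AddHom.coe_mk, Fintype.sum_sum_type,
    Sum.elim_inl, Sum.elim_inr, Fintype.sum_prod_type, Matrix.trace, Matrix.diag_apply,
    Matrix.mul_apply, Matrix.conjTranspose_apply, Complex.re_sum, Complex.mul_re,
    ← Finset.sum_add_distrib]
  refine Finset.sum_congr rfl fun i _ => Finset.sum_congr rfl fun j _ => ?_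
  simp

lemma trace_mul_re_eq_of_isHermitian (A : Matrix m m ℂ) {L : Matrix m m ℂ}
    (hL : L.IsHermitian) : (A * L).trace.re = matVec A ⬝ᵥ matVec L := by
  rw [matVec_dotProduct, hL.eq]

/-- For Hermitian `A`, Tr(AL*) is the conjugate of Tr(AL), so the real pairing does not see the
anti-Hermitian part of `L`. -/
lemma trace_mul_hermPart_re {A : Matrix m m ℂ} (hA : A.IsHermitian) (L : Matrix m m ℂ) :
    (A * hermPart L).trace.re = matVec A ⬝ᵥ matVec L := by
  have h1 : (A * L).trace.re = (A * L.conjTranspose).trace.re := by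
    have : (A * L.conjTranspose).trace = star (A * L).trace := by
      rw [← Matrix.trace_conjTranspose, Matrix.conjTranspose_mul, hA.eq, Matrix.trace_mul_comm]
    rw [this]
    simp
  rw [matVec_dotProduct, hermPart, Matrix.mul_smul, Matrix.trace_smul, Complex.smul_re,
    Matrix.mul_add, Matrix.trace_add, Complex.add_re, h1, smul_eq_mul]
  ring

lemma quadForm_eq_trace (M : Matrix m m ℂ) (v : m → ℂ) :
    quadForm M v = (Matrix.vecMulVec v (star v) * M).trace.re := by
  rw [quadForm, Matrix.trace_mul_comm, Matrix.mul_vecMulVec, Matrix.trace_vecMulVec,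
    dotProduct_comm]

lemma quadForm_eq_of_isHermitian {L : Matrix m m ℂ} (hL : L.IsHermitian) (v : m → ℂ) :
    quadForm L v = matVec (Matrix.vecMulVec v (star v)) ⬝ᵥ matVec L := by
  rw [quadForm_eq_trace, trace_mul_re_eq_of_isHermitian _ hL]

lemma quadForm_hermPart (L : Matrix m m ℂ) (v : m → ℂ) :
    quadForm (hermPart L) v = matVec (Matrix.vecMulVec v (star v)) ⬝ᵥ matVec L := by
  rw [quadForm_eq_trace, trace_mul_hermPart_re (isHermitian_vecMulVec_star v)]

end Hermitian

/-! ### Products of two complex unit spheres. -/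

section Spheres

variable {n : ℕ}

lemma outer_kronecker_outer (x y : Fin n → ℂ) : outer x ⊗ₖ outer y =
    Matrix.vecMulVec (fun p : Fin n × Fin n => x p.1 * y p.2)
      (star fun p : Fin n × Fin n => x p.1 * y p.2) := by
  ext p q
  simp only [outer, Matrix.kroneckerMap_apply, Matrix.vecMulVec_apply, Pi.star_apply, star_mul']
  ring

lemma trace_outer (x : Fin n → ℂ) : (outer x).trace = ((∑ i, ‖x i‖ ^ 2 : ℝ) : ℂ) := by
  rw [outer, Matrix.trace_vecMulVec, dotProduct, Complex.ofReal_sum]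
  refine Finset.sum_congr rfl fun i _ => ?_
  rw [Pi.star_apply, Complex.star_def, Complex.mul_conj, Complex.normSq_eq_norm_sq]

lemma outer_smul (a : ℝ) (x : Fin n → ℂ) : outer (a • x) = (a ^ 2) • outer x := by
  ext i j
  simp only [outer, Matrix.vecMulVec_apply, Matrix.smul_apply, Pi.smul_apply, Pi.star_apply,
    star_smul, star_trivial, Complex.real_smul]
  push_cast
  ring

lemma complexSphere_nonempty (hn : 1 ≤ n) : (complexSphere n).Nonempty := by
  refine ⟨Pi.single ⟨0, hn⟩ 1, ?_⟩
  have : ∀ i, ‖(Pi.single (⟨0, hn⟩ : Fin n) (1 : ℂ) : Fin n → ℂ) i‖ ^ 2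
      = if i = ⟨0, hn⟩ then 1 else 0 := by
    intro i
    rw [Pi.single_apply]
    split_ifs <;> simp
  simp [complexSphere, this]

/-- A rank one matrix is a nonnegative multiple of the one of a unit vector. -/
lemma exists_outer_eq_smul (hn : 1 ≤ n) (x : Fin n → ℂ) :
    ∃ u ∈ complexSphere n, outer x = (∑ i, ‖x i‖ ^ 2) • outer u := by
  by_cases hx : ∑ i, ‖x i‖ ^ 2 = 0
  · obtain ⟨u, hu⟩ := complexSphere_nonempty hn
    refine ⟨u, hu, ?_⟩
    rw [hx, zero_smul]
    have : x = 0 := by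
      funext i
      rw [Finset.sum_eq_zero_iff_of_nonneg fun _ _ => sq_nonneg _] at hx
      simpa using hx i (Finset.mem_univ i)
    subst this
    simp [outer]
  · have hpos : 0 < ∑ i, ‖x i‖ ^ 2 :=
      lt_of_le_of_ne (Finset.sum_nonneg fun _ _ => sq_nonneg _) (Ne.symm hx)
    have hsq := Real.sq_sqrt hpos.le
    have h0 : Real.sqrt (∑ i, ‖x i‖ ^ 2) ≠ 0 := (Real.sqrt_pos.2 hpos).ne'
    refine ⟨(Real.sqrt (∑ i, ‖x i‖ ^ 2))⁻¹ • x, ?_, ?_⟩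
    · change ∑ i, ‖((Real.sqrt (∑ i, ‖x i‖ ^ 2))⁻¹ • x) i‖ ^ 2 = 1
      simp only [Pi.smul_apply, norm_smul, mul_pow, ← Finset.mul_sum, norm_inv, Real.norm_eq_abs,
        sq_abs, inv_pow, hsq]
      exact inv_mul_cancel₀ hx
    · rw [outer_smul, inv_pow, hsq, smul_smul, mul_inv_cancel₀ hx, one_smul]

/-- The real point of the product of two complex spheres with the given complex coordinates. -/
def pairPoint (x y : Fin n → ℂ) : (Fin 2 × Fin n) ⊕ (Fin 2 × Fin n) → ℝ :=
  realPoint fun v => ![x, y] v.1 v.2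

lemma exists_eq_pairPoint (p : (Fin 2 × Fin n) ⊕ (Fin 2 × Fin n) → ℝ) :
    ∃ x y : Fin n → ℂ, p = pairPoint x y := by
  refine ⟨fun i => complexPoint p (0, i), fun i => complexPoint p (1, i), ?_⟩
  funext u
  rcases u with ⟨s, i⟩ | ⟨s, i⟩ <;> fin_cases s <;> rfl

variable {ι : Type} {f : MvPolynomial ((Fin 2 × Fin n) ⊕ (Fin 2 × Fin n)) ℂ}
  {h : ι → MvPolynomial ((Fin 2 × Fin n) ⊕ (Fin 2 × Fin n)) ℂ} {b : ι → ℂ}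

lemma pairPoint_mem_feasSet_iff (x y : Fin n → ℂ) :
    pairPoint x y ∈ (realifyGMP (Prod.fst : Fin 2 × Fin n → Fin 2) f h b).feasSet ↔
      x ∈ complexSphere n ∧ y ∈ complexSphere n := by
  rw [SphereGMP.mem_feasSet_iff, Fin.forall_fin_two]
  rw [Finset.sum_filter, Finset.sum_filter, Fintype.sum_sum_type, Fintype.sum_sum_type]
  simp [realifyGMP, Fintype.sum_prod_type, pairPoint, realPoint, complexSphere,
    ← Finset.sum_add_distrib, Complex.sq_norm, Complex.normSq_apply, ← sq]

lemma surjective_blk_realifyGMP (hn : 1 ≤ n) :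
    Function.Surjective (realifyGMP (Prod.fst : Fin 2 × Fin n → Fin 2) f h b).blk :=
  fun l => ⟨Sum.inl (l, ⟨0, hn⟩), rfl⟩

@[simp] lemma evalConj_zVar (z : Fin 2 × Fin n → ℂ) (s : Fin 2) (i : Fin n) :
    evalConj z (zVar s i) = z (s, i) := by
  simp [evalConj, zVar]

@[simp] lemma evalConj_zBar (z : Fin 2 × Fin n → ℂ) (s : Fin 2) (i : Fin n) :
    evalConj z (zBar s i) = (starRingEnd ℂ) (z (s, i)) := by
  simp [evalConj, zBar]

@[simp] lemma complexPoint_pairPoint_zero (x y : Fin n → ℂ) (i : Fin n) :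
    complexPoint (pairPoint x y) (0, i) = x i := rfl

@[simp] lemma complexPoint_pairPoint_one (x y : Fin n → ℂ) (i : Fin n) :
    complexPoint (pairPoint x y) (1, i) = y i := rfl

end Spheres

/-! ### The DPS hierarchy. -/

section DPS

variable {n : ℕ}

lemma momentVec_dpsGMP (ρ : Matrix (Fin n × Fin n) (Fin n × Fin n) ℂ) (x y : Fin n → ℂ) :
    (dpsGMP n ρ).momentVec (pairPoint x y) = matVec (outer x ⊗ₖ outer y) := by
  rw [dpsGMP, momentVec_realifyGMP]
  simp [matVec, outer, Matrix.vecMulVec_apply]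

lemma b_dpsGMP (ρ : Matrix (Fin n × Fin n) (Fin n × Fin n) ℂ) : (dpsGMP n ρ).b = matVec ρ := rfl

lemma mem_feasSet_dpsGMP {ρ : Matrix (Fin n × Fin n) (Fin n × Fin n) ℂ} {x y : Fin n → ℂ} :
    pairPoint x y ∈ (dpsGMP n ρ).feasSet ↔ x ∈ complexSphere n ∧ y ∈ complexSphere n :=
  pairPoint_mem_feasSet_iff x y

lemma eval_dualPoly_dpsGMP (ρ L : Matrix (Fin n × Fin n) (Fin n × Fin n) ℂ) (x y : Fin n → ℂ) :
    eval (pairPoint x y) ((dpsGMP n ρ).dualPoly (matVec L)) =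
      1 - matVec (outer x ⊗ₖ outer y) ⬝ᵥ matVec L := by
  rw [SphereGMP.eval_dualPoly, momentVec_dpsGMP]
  congr 1
  exact (eval_polyRe _ _).trans (by rw [map_one, Complex.one_re])

lemma isHermitian_of_mem_momentCone_dpsGMP {ρ : Matrix (Fin n × Fin n) (Fin n × Fin n) ℂ}
    (h : (dpsGMP n ρ).b ∈ (dpsGMP n ρ).momentCone) : ρ.IsHermitian := by
  unfold dpsGMP at h
  ext p q
  rw [Matrix.conjTranspose_apply, Complex.star_def]
  refine (eq_conj_of_mem_momentCone_realifyGMP h (i := (q, p))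
    (j := (p, q)) fun z => ?_).symm
  simp only [map_mul, evalConj_zVar, evalConj_zBar, Complex.conj_conj]
  ring

/-- Normalize the vectors and absorb their squared norms into the weights; the result is an atomic
measure on the product of spheres. -/
lemma matVec_mem_momentCone_of_mem_separableCone (hn : 1 ≤ n)
    {ρ ρ' : Matrix (Fin n × Fin n) (Fin n × Fin n) ℂ} (h : ρ' ∈ separableCone n) :
    matVec ρ' ∈ (dpsGMP n ρ).momentCone := by
  obtain ⟨r, w, x, y, hw, rfl⟩ := h
  rw [map_sum]
  refine SphereGMP.sum_mem_momentCone fun l _ => ?_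
  rw [map_smul]
  refine SphereGMP.smul_mem_momentCone ?_ (hw l)
  obtain ⟨u, hu, hxu⟩ := exists_outer_eq_smul hn (x l)
  obtain ⟨v, hv, hyv⟩ := exists_outer_eq_smul hn (y l)
  rw [hxu, hyv, Matrix.smul_kronecker, Matrix.kronecker_smul, map_smul, map_smul,
    ← momentVec_dpsGMP ρ]
  exact SphereGMP.smul_mem_momentCone (SphereGMP.smul_mem_momentCone
    (SphereGMP.momentVec_mem_momentCone (mem_feasSet_dpsGMP.2 ⟨hu, hv⟩))
    (Finset.sum_nonneg fun _ _ => sq_nonneg _)) (Finset.sum_nonneg fun _ _ => sq_nonneg _)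

/-- The small step is taken inside SEP and only then mapped to K, so relative interiors need not be
transported between the two spaces. -/
lemma strictlyFeasible_dpsGMP_of_mem_intrinsicInterior (hn : 1 ≤ n)
    {ρ : Matrix (Fin n × Fin n) (Fin n × Fin n) ℂ}
    (h : ρ ∈ intrinsicInterior ℝ (separableCone n)) : (dpsGMP n ρ).StrictlyFeasible := by
  refine ⟨matVec_mem_momentCone_of_mem_separableCone hn (intrinsicInterior_subset h),
    fun p _ => ?_⟩
  obtain ⟨x, y, rfl⟩ := exists_eq_pairPoint p
  have h0 : (0 : Matrix (Fin n × Fin n) (Fin n × Fin n) ℂ) ∈ separableCone n :=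
    ⟨0, Fin.elim0, Fin.elim0, Fin.elim0, fun l => l.elim0, by simp⟩
  have h1 : outer x ⊗ₖ outer y ∈ separableCone n :=
    ⟨1, fun _ => 1, fun _ => x, fun _ => y, fun _ => zero_le_one, by simp⟩
  obtain ⟨ε, hε, hmem⟩ := exists_pos_sub_smul_mem_of_mem_intrinsicInterior h0 h h1
  refine ⟨ε, hε, ?_⟩
  rw [momentVec_dpsGMP, b_dpsGMP, ← map_smul, ← map_sub]
  exact matVec_mem_momentCone_of_mem_separableCone hn hmem

/-- The real multipliers range over all complex matrices. Passing to the Hermitian part keeps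
objective and constraints, because ρ and the rank-one matrices are Hermitian. -/
lemma dpsDualAttained_of_dualityAttainment {ρ : Matrix (Fin n × Fin n) (Fin n × Fin n) ℂ}
    (hρ : ρ.IsHermitian) (h : (dpsGMP n ρ).DualityAttainment) : DPSDualAttained n ρ := by
  obtain ⟨lam, hlam, hmax⟩ := h
  obtain ⟨L, rfl⟩ := matVec_surjective lam
  refine ⟨hermPart L, ⟨isHermitian_hermPart L, fun x hx y hy => ?_⟩, ?_⟩
  · have := hlam _ (mem_feasSet_dpsGMP.2 ⟨hx, hy⟩)
    rwa [eval_dualPoly_dpsGMP, outer_kronecker_outer, ← quadForm_hermPart] at this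
  · rintro M ⟨hM, hMfeas⟩
    have hmem : matVec M ∈ {lam | ∀ x ∈ (dpsGMP n ρ).feasSet,
        0 ≤ eval x ((dpsGMP n ρ).dualPoly lam)} := by
      intro p hp
      obtain ⟨x, y, rfl⟩ := exists_eq_pairPoint p
      obtain ⟨hx, hy⟩ := mem_feasSet_dpsGMP.1 hp
      rw [eval_dualPoly_dpsGMP, outer_kronecker_outer, ← quadForm_eq_of_isHermitian hM]
      exact hMfeas x hx y hy
    have hle : matVec ρ ⬝ᵥ matVec M ≤ matVec ρ ⬝ᵥ matVec L := hmax hmem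
    rw [← trace_mul_re_eq_of_isHermitian _ hM, ← trace_mul_hermPart_re hρ] at hle
    exact hle

/-- Duality attainment for the DPS hierarchy. -/
theorem dps_attainment (hn : 1 ≤ n) {ρ : Matrix (Fin n × Fin n) (Fin n × Fin n) ℂ}
    (h : (dpsGMP n ρ).RelintAssumption ∨ ρ ∈ intrinsicInterior ℝ (separableCone n)) :
    DPSDualAttained n ρ ∧ (dpsGMP n ρ).DualityAttainment ∧
      ∀ t : ℕ, (dpsGMP n ρ).tMin ≤ t → (dpsGMP n ρ).RelaxDualityAttainment t := by
  have hG : (dpsGMP n ρ).StrictlyFeasible :=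
    h.elim (fun h => h.strictlyFeasible) (strictlyFeasible_dpsGMP_of_mem_intrinsicInterior hn)
  have hone : ∃ lam, ∀ x ∈ (dpsGMP n ρ).feasSet, (dpsGMP n ρ).momentVec x ⬝ᵥ lam = 1 := by
    -- Pairing with the identity takes the trace, which is ‖x‖²‖y‖² = 1.
    refine ⟨matVec 1, fun p hp => ?_⟩
    obtain ⟨x, y, rfl⟩ := exists_eq_pairPoint p
    obtain ⟨hx, hy⟩ := mem_feasSet_dpsGMP.1 hp
    rw [momentVec_dpsGMP, matVec_dotProduct, Matrix.conjTranspose_one, mul_one,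
      Matrix.trace_kronecker, trace_outer, trace_outer, show ∑ i, ‖x i‖ ^ 2 = 1 from hx,
      show ∑ i, ‖y i‖ ^ 2 = 1 from hy]
    simp
  have hmain := hG.dualityAttainment _ (surjective_blk_realifyGMP hn) hone
  exact ⟨dpsDualAttained_of_dualityAttainment (isHermitian_of_mem_momentCone_dpsGMP hG.1) hmain.1,
    hmain⟩

end DPS

/-! ### Subtracting rank-one projections from positive definite matrices. -/

section PosDef

variable {n : ℕ}

/-- For a unit vector this is an orthogonal projection, so it equals its adjoint times itself. -/
lemma posSemidef_one_sub_outer {x : Fin n → ℂ} (hx : x ∈ complexSphere n) :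
    (1 - outer x).PosSemidef := by
  have hxx : star x ⬝ᵥ x = 1 := by
    have := trace_outer x
    rw [show ∑ i, ‖x i‖ ^ 2 = 1 from hx, outer, Matrix.trace_vecMulVec, dotProduct_comm] at this
    simpa using this
  have hidem : outer x * outer x = outer x := by
    rw [outer, Matrix.vecMulVec_mul_vecMulVec, hxx, one_smul]
  have hherm : (outer x).conjTranspose = outer x := isHermitian_vecMulVec_star x
  have h := Matrix.posSemidef_conjTranspose_mul_self (1 - outer x)
  rw [Matrix.conjTranspose_sub, Matrix.conjTranspose_one, hherm, sub_mul, one_mul, mul_sub, mul_one,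
    hidem, sub_self, sub_zero] at h
  exact h

open scoped MatrixOrder in
lemma Matrix.PosDef.exists_posSemidef_sub_smul_one {τ : Matrix (Fin n) (Fin n) ℂ}
    (hτ : τ.PosDef) : ∃ δ : ℝ, 0 < δ ∧ (τ - δ • (1 : Matrix (Fin n) (Fin n) ℂ)).PosSemidef := by
  obtain ⟨δ, hδ, hle⟩ : ∃ δ : ℝ, 0 < δ ∧ ∀ i, δ ≤ hτ.1.eigenvalues i := by
    rcases isEmpty_or_nonempty (Fin n) with he | hne
    · exact ⟨1, one_pos, fun i => he.elim i⟩
    · obtain ⟨i, hi⟩ := Finite.exists_min hτ.1.eigenvalues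
      exact ⟨_, hτ.eigenvalues_pos i, hi⟩
  refine ⟨δ, hδ, ?_⟩
  rw [← Matrix.le_iff, ← Algebra.algebraMap_eq_smul_one,
    algebraMap_le_iff_le_spectrum hτ.1.isSelfAdjoint, hτ.1.spectrum_real_eq_range_eigenvalues]
  rintro _ ⟨i, rfl⟩
  exact hle i

/-- With δ the constant of `exists_posSemidef_sub_smul_one`, split τ - ε xx* = (τ - δ1) + (δ - ε)1 +
ε(1 - xx*). A whole range of ε is allowed so that one step can serve both marginals. -/
lemma Matrix.PosDef.exists_posSemidef_sub_smul_outer {τ : Matrix (Fin n) (Fin n) ℂ}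
    (hτ : τ.PosDef) : ∃ δ : ℝ, 0 < δ ∧ ∀ x ∈ complexSphere n, ∀ ε : ℝ, 0 ≤ ε → ε ≤ δ →
      (τ - ε • outer x).PosSemidef := by
  obtain ⟨δ, hδ, h⟩ := hτ.exists_posSemidef_sub_smul_one
  refine ⟨δ, hδ, fun x hx ε hε hεδ => ?_⟩
  have key : τ - ε • outer x = (τ - δ • (1 : Matrix (Fin n) (Fin n) ℂ))
      + (δ - ε) • (1 : Matrix (Fin n) (Fin n) ℂ) + ε • (1 - outer x) := by
    rw [sub_smul, smul_sub]
    abel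
  rw [key]
  exact (h.add (Matrix.PosSemidef.one.smul (sub_nonneg.2 hεδ))).add
    ((posSemidef_one_sub_outer hx).smul hε)

end PosDef

/-! ### The order-2 quantum Wasserstein distance. -/

section Wasserstein

variable {n : ℕ}

/-- The vector of real and imaginary parts of the entries of a pair of complex matrices. -/
def pairVec : (Matrix (Fin n) (Fin n) ℂ × Matrix (Fin n) (Fin n) ℂ) →ₗ[ℝ]
    (((Fin n × Fin n) ⊕ (Fin n × Fin n)) ⊕ ((Fin n × Fin n) ⊕ (Fin n × Fin n)) → ℝ) where
  toFun P := Sum.elim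
    (fun i => (Sum.elim (fun p => P.1 p.1 p.2) (fun p => P.2 p.1 p.2) i : ℂ).re)
    (fun i => (Sum.elim (fun p => P.1 p.1 p.2) (fun p => P.2 p.1 p.2) i : ℂ).im)
  map_add' M N := by
    funext i; rcases i with (i | i) | (i | i) <;> simp
  map_smul' c M := by
    funext i; rcases i with (i | i) | (i | i) <;> simp

lemma pairVec_surjective : Function.Surjective (pairVec (n := n)) := by
  intro lam
  refine ⟨(Matrix.of fun i j => ⟨lam (Sum.inl (Sum.inl (i, j))), lam (Sum.inr (Sum.inl (i, j)))⟩,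
    Matrix.of fun i j => ⟨lam (Sum.inl (Sum.inr (i, j))), lam (Sum.inr (Sum.inr (i, j)))⟩), ?_⟩
  funext i
  rcases i with (i | i) | (i | i) <;> rfl

lemma pairVec_dotProduct (P Q : Matrix (Fin n) (Fin n) ℂ × Matrix (Fin n) (Fin n) ℂ) :
    pairVec P ⬝ᵥ pairVec Q = matVec P.1 ⬝ᵥ matVec Q.1 + matVec P.2 ⬝ᵥ matVec Q.2 := by
  simp only [dotProduct, matVec, pairVec, LinearMap.coe_mk, AddHom.coe_mk, Fintype.sum_sum_type,
    Sum.elim_inl, Sum.elim_inr]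
  ring

variable {τ ω : Matrix (Fin n) (Fin n) ℂ}

lemma momentVec_wassersteinGMP (x y : Fin n → ℂ) :
    (wassersteinGMP n τ ω).momentVec (pairPoint x y) = pairVec (outer x, outer y) := by
  rw [wassersteinGMP, momentVec_realifyGMP]
  funext i
  rcases i with (i | i) | (i | i) <;> simp [pairVec, outer, Matrix.vecMulVec_apply]

lemma b_wassersteinGMP : (wassersteinGMP n τ ω).b = pairVec (τ, ω) := rfl

lemma mem_feasSet_wassersteinGMP {x y : Fin n → ℂ} :
    pairPoint x y ∈ (wassersteinGMP n τ ω).feasSet ↔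
      x ∈ complexSphere n ∧ y ∈ complexSphere n :=
  pairPoint_mem_feasSet_iff x y

lemma eval_costPoly (x y : Fin n → ℂ) :
    (evalConj (complexPoint (pairPoint x y)) (costPoly n)).re = cost x y := by
  unfold costPoly cost
  simp only [Matrix.trace, Matrix.diag_apply, Matrix.mul_apply, Matrix.of_apply, map_sum, map_mul,
    map_sub, evalConj_zVar, evalConj_zBar, complexPoint_pairPoint_zero,
    complexPoint_pairPoint_one, Matrix.map_apply, Matrix.sub_apply, outer, Matrix.vecMulVec_apply,
    Pi.star_apply, Complex.star_def, Complex.conj_conj]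

lemma eval_dualPoly_wassersteinGMP (P : Matrix (Fin n) (Fin n) ℂ × Matrix (Fin n) (Fin n) ℂ)
    (x y : Fin n → ℂ) :
    eval (pairPoint x y) ((wassersteinGMP n τ ω).dualPoly (pairVec P)) =
      cost x y - matVec (outer x) ⬝ᵥ matVec P.1 - matVec (outer y) ⬝ᵥ matVec P.2 := by
  rw [SphereGMP.eval_dualPoly, momentVec_wassersteinGMP, pairVec_dotProduct, ← sub_sub,
    ← eval_costPoly]
  congr 2
  exact eval_polyRe _ _

lemma isHermitian_of_mem_momentCone_wassersteinGMP
    (h : (wassersteinGMP n τ ω).b ∈ (wassersteinGMP n τ ω).momentCone) :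
    τ.IsHermitian ∧ ω.IsHermitian := by
  unfold wassersteinGMP at h
  constructor
  · ext p q
    rw [Matrix.conjTranspose_apply, Complex.star_def]
    refine (eq_conj_of_mem_momentCone_realifyGMP h
      (i := Sum.inl (q, p))
      (j := Sum.inl (p, q)) fun z => ?_).symm
    simp only [Sum.elim_inl, map_mul, evalConj_zVar, evalConj_zBar, Complex.conj_conj]
    ring
  · ext p q
    rw [Matrix.conjTranspose_apply, Complex.star_def]
    refine (eq_conj_of_mem_momentCone_realifyGMP h
      (i := Sum.inr (q, p))
      (j := Sum.inr (p, q)) fun z => ?_).symm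
    simp only [Sum.elim_inr, map_mul, evalConj_zVar, evalConj_zBar, Complex.conj_conj]
    ring

/-- A pair of positive semidefinite matrices of equal positive trace is a pair of marginal
moments: take a product measure. -/
lemma pairVec_mem_momentCone (hn : 1 ≤ n) {A B : Matrix (Fin n) (Fin n) ℂ} (hA : A.PosSemidef)
    (hB : B.PosSemidef) {c : ℝ} (hc : 0 < c) (hAc : A.trace = (c : ℂ)) (hBc : B.trace = (c : ℂ)) :
    pairVec (A, B) ∈ (wassersteinGMP n τ ω).momentCone := by
  obtain ⟨r, v, hv⟩ := Matrix.posSemidef_iff_eq_sum_vecMulVec.1 hA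
  obtain ⟨s, w, hw⟩ := Matrix.posSemidef_iff_eq_sum_vecMulVec.1 hB
  have htr : ∀ {k : ℕ} {u : Fin k → Fin n → ℂ} {M : Matrix (Fin n) (Fin n) ℂ},
      M = ∑ i, Matrix.vecMulVec (u i) (star (u i)) → M.trace = (c : ℂ) →
      ∑ i, ∑ j, ‖u i j‖ ^ 2 = c := by
    intro k u M hM hMc
    have h1 : M = ∑ i, outer (u i) := hM
    rw [h1, Matrix.trace_sum] at hMc
    simp only [trace_outer] at hMc
    exact_mod_cast hMc
  have hvc := htr hv hAc
  have hwc := htr hw hBc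
  -- The product measure puts mass ‖v_i‖²‖w_j‖² at the normalized pair. Summing out either index
  -- yields the common trace `c`, so the marginal moments are cA and cB.
  have hsum : ∑ i, ∑ j, pairVec ((∑ k, ‖w j k‖ ^ 2) • outer (v i), (∑ k, ‖v i k‖ ^ 2) • outer (w j))
      = c • pairVec (A, B) := by
    simp only [← map_sum, ← map_smul]
    congr 1
    ext1
    · rw [Prod.fst_sum]
      simp only [Prod.fst_sum, ← Finset.sum_smul, hwc, ← Finset.smul_sum]
      rw [Prod.smul_fst, hv]
      rfl
    · rw [Prod.snd_sum]
      simp only [Prod.snd_sum, ← Finset.smul_sum]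
      rw [← Finset.sum_smul, hvc, Prod.smul_snd, hw]
      rfl
  have hmem : c • pairVec (A, B) ∈ (wassersteinGMP n τ ω).momentCone := by
    rw [← hsum]
    refine SphereGMP.sum_mem_momentCone fun i _ => SphereGMP.sum_mem_momentCone fun j _ => ?_
    obtain ⟨x, hx, hvx⟩ := exists_outer_eq_smul hn (v i)
    obtain ⟨y, hy, hwy⟩ := exists_outer_eq_smul hn (w j)
    have : ((∑ k, ‖w j k‖ ^ 2) • outer (v i), (∑ k, ‖v i k‖ ^ 2) • outer (w j))
        = ((∑ k, ‖w j k‖ ^ 2) * ∑ k, ‖v i k‖ ^ 2) • (outer x, outer y) := by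
      rw [hvx, hwy, smul_smul, smul_smul, Prod.smul_mk, mul_comm (∑ k, ‖v i k‖ ^ 2)]
    rw [this, map_smul, ← momentVec_wassersteinGMP (τ := τ) (ω := ω)]
    exact SphereGMP.smul_mem_momentCone
      (SphereGMP.momentVec_mem_momentCone (mem_feasSet_wassersteinGMP.2 ⟨hx, hy⟩))
      (mul_nonneg (Finset.sum_nonneg fun _ _ => sq_nonneg _)
        (Finset.sum_nonneg fun _ _ => sq_nonneg _))
  have := SphereGMP.smul_mem_momentCone hmem (inv_nonneg.2 hc.le)
  rwa [smul_smul, inv_mul_cancel₀ hc.ne', one_smul] at this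

lemma strictlyFeasible_wassersteinGMP_of_posDef (hn : 1 ≤ n) (hτ : τ.PosDef) (hω : ω.PosDef)
    (hτ1 : τ.trace = 1) (hω1 : ω.trace = 1) : (wassersteinGMP n τ ω).StrictlyFeasible := by
  refine ⟨pairVec_mem_momentCone hn hτ.posSemidef hω.posSemidef one_pos (by simpa using hτ1)
    (by simpa using hω1), fun p hp => ?_⟩
  obtain ⟨x, y, rfl⟩ := exists_eq_pairPoint p
  obtain ⟨hx, hy⟩ := mem_feasSet_wassersteinGMP.1 hp
  obtain ⟨δ, hδ, h⟩ := hτ.exists_posSemidef_sub_smul_outer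
  obtain ⟨δ', hδ', h'⟩ := hω.exists_posSemidef_sub_smul_outer
  -- Both traces drop to 1 - ε, staying equal as the product measure requires; the cap 1/2 keeps
  -- them positive.
  have hε : 0 < min (1 / 2) (min δ δ') := by positivity
  have hε1 : min (1 / 2) (min δ δ') ≤ 1 / 2 := min_le_left _ _
  have hεδ : min (1 / 2) (min δ δ') ≤ δ := (min_le_right _ _).trans (min_le_left _ _)
  have hεδ' : min (1 / 2) (min δ δ') ≤ δ' := (min_le_right _ _).trans (min_le_right _ _)
  generalize min (1 / 2) (min δ δ') = ε at hε hε1 hεδ hεδ'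
  refine ⟨ε, hε, ?_⟩
  rw [momentVec_wassersteinGMP, b_wassersteinGMP, ← map_smul, ← map_sub]
  have htr : ∀ {M : Matrix (Fin n) (Fin n) ℂ} {u : Fin n → ℂ}, M.trace = 1 →
      u ∈ complexSphere n → (M - ε • outer u).trace = ((1 - ε : ℝ) : ℂ) := by
    intro M u hM hu
    rw [Matrix.trace_sub, Matrix.trace_smul, hM, trace_outer,
      show ∑ i, ‖u i‖ ^ 2 = 1 from hu]
    simp
  exact pairVec_mem_momentCone hn (h x hx ε hε.le hεδ) (h' y hy ε hε.le hεδ')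
    (by linarith : 0 < 1 - ε) (htr hτ1 hx) (htr hω1 hy)

lemma wassersteinDualAttained_of_dualityAttainment (hτ : τ.IsHermitian) (hω : ω.IsHermitian)
    (h : (wassersteinGMP n τ ω).DualityAttainment) : WassersteinDualAttained n τ ω := by
  obtain ⟨lam, hlam, hmax⟩ := h
  obtain ⟨⟨L, Γ⟩, rfl⟩ := pairVec_surjective lam
  refine ⟨(hermPart L, hermPart Γ), ⟨isHermitian_hermPart L, isHermitian_hermPart Γ,
    fun x hx y hy => ?_⟩, ?_⟩
  · have := hlam _ (mem_feasSet_wassersteinGMP.2 ⟨hx, hy⟩)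
    rw [eval_dualPoly_wassersteinGMP] at this
    rw [quadForm_hermPart, quadForm_hermPart]
    exact this
  · rintro ⟨M, N⟩ ⟨hM, hN, hfeas⟩
    have hmem : pairVec (M, N) ∈ {lam | ∀ x ∈ (wassersteinGMP n τ ω).feasSet,
        0 ≤ eval x ((wassersteinGMP n τ ω).dualPoly lam)} := by
      intro p hp
      obtain ⟨x, y, rfl⟩ := exists_eq_pairPoint p
      obtain ⟨hx, hy⟩ := mem_feasSet_wassersteinGMP.1 hp
      have := hfeas x hx y hy
      rw [quadForm_eq_of_isHermitian hM, quadForm_eq_of_isHermitian hN] at this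
      rw [eval_dualPoly_wassersteinGMP]
      exact this
    have hle : pairVec (τ, ω) ⬝ᵥ pairVec (M, N) ≤ pairVec (τ, ω) ⬝ᵥ pairVec (L, Γ) := hmax hmem
    rw [pairVec_dotProduct, pairVec_dotProduct, ← trace_mul_re_eq_of_isHermitian _ hM,
      ← trace_mul_re_eq_of_isHermitian _ hN, ← trace_mul_hermPart_re hτ,
      ← trace_mul_hermPart_re hω, ← Complex.add_re, ← Complex.add_re, ← Matrix.trace_add,
      ← Matrix.trace_add] at hle
    exact hle

/-- Duality attainment for the order-2 quantum Wasserstein distance. -/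
theorem wasserstein_attainment (hn : 1 ≤ n) (hτ1 : τ.trace = 1) (hω1 : ω.trace = 1)
    (h : (wassersteinGMP n τ ω).RelintAssumption ∨ (τ.PosDef ∧ ω.PosDef)) :
    WassersteinDualAttained n τ ω ∧ (wassersteinGMP n τ ω).DualityAttainment ∧
      ∀ t : ℕ, (wassersteinGMP n τ ω).tMin ≤ t →
        (wassersteinGMP n τ ω).RelaxDualityAttainment t := by
  have hG : (wassersteinGMP n τ ω).StrictlyFeasible :=
    h.elim (fun h => h.strictlyFeasible)
      fun h => strictlyFeasible_wassersteinGMP_of_posDef hn h.1 h.2 hτ1 hω1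
  have hone : ∃ lam, ∀ x ∈ (wassersteinGMP n τ ω).feasSet,
      (wassersteinGMP n τ ω).momentVec x ⬝ᵥ lam = 1 := by
    -- The trace of the first marginal alone already gives the constant 1.
    refine ⟨pairVec (1, 0), fun p hp => ?_⟩
    obtain ⟨x, y, rfl⟩ := exists_eq_pairPoint p
    obtain ⟨hx, hy⟩ := mem_feasSet_wassersteinGMP.1 hp
    rw [momentVec_wassersteinGMP, pairVec_dotProduct, matVec_dotProduct,
      Matrix.conjTranspose_one, mul_one, trace_outer, show ∑ i, ‖x i‖ ^ 2 = 1 from hx]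
    simp
  have hmain := hG.dualityAttainment _ (surjective_blk_realifyGMP hn) hone
  obtain ⟨hτ, hω⟩ := isHermitian_of_mem_momentCone_wassersteinGMP hG.1
  exact ⟨wassersteinDualAttained_of_dualityAttainment hτ hω hmain.1, hmain⟩

end Wasserstein

/-! ### Best rank-one approximation of real tensors. -/

section Tensor

/-- Duality attainment for the best rank-one approximation of a real tensor. -/
theorem tensor_attainment {a : ℕ} {n : Fin a → ℕ} (A : ((l : Fin a) → Fin (n l)) → ℝ)
    (hn : ∀ l, 1 ≤ n l) :
    (tensorGMP n A).DualityAttainment ∧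
      ∀ t : ℕ, (tensorGMP n A).tMin ≤ t → (tensorGMP n A).RelaxDualityAttainment t := by
  have hvec : ∀ x, (tensorGMP n A).momentVec x = 1 := fun x => funext fun _ => map_one _
  have hb : (tensorGMP n A).b = 1 := rfl
  obtain ⟨x₀, hx₀⟩ : (tensorGMP n A).feasSet.Nonempty := by
    refine ⟨fun v => if v.2 = ⟨0, hn v.1⟩ then 1 else 0, ?_⟩
    rw [SphereGMP.mem_feasSet_iff]
    intro l
    rw [Finset.sum_filter, Fintype.sum_sigma, Finset.sum_eq_single l]
    · simp [tensorGMP]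
      exact Finset.card_eq_one.2 ⟨⟨0, hn l⟩, by ext; simp⟩
    · intro k _ hk
      simp [tensorGMP, hk]
    · simp
  have hmem : (1 : Fin 1 → ℝ) ∈ (tensorGMP n A).momentCone := by
    rw [← hvec x₀]
    exact SphereGMP.momentVec_mem_momentCone hx₀
  have hG : (tensorGMP n A).StrictlyFeasible := by
    -- Every moment vector equals b, so the full step ε = 1 lands at 0, the moment vector of the
    -- zero measure.
    refine ⟨hmem, fun x _ => ⟨1, one_pos, ?_⟩⟩
    rw [hvec, hb, one_smul, sub_self]
    exact SphereGMP.zero_mem_momentCone _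
  refine hG.dualityAttainment _ (fun l => ⟨⟨l, ⟨0, hn l⟩⟩, rfl⟩) ⟨1, fun x _ => ?_⟩
  rw [hvec]
  simp

end Tensor

theorem corollary6p2 :
    (∀ (n : ℕ) (ρ : Matrix (Fin n × Fin n) (Fin n × Fin n) ℂ), 1 ≤ n →
      (dpsGMP n ρ).RelintAssumption ∨ ρ ∈ intrinsicInterior ℝ (separableCone n) →
        DPSDualAttained n ρ ∧ (dpsGMP n ρ).DualityAttainment ∧
        ∀ t : ℕ, (dpsGMP n ρ).tMin ≤ t → (dpsGMP n ρ).RelaxDualityAttainment t) ∧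
    (∀ (n : ℕ) (τ ω : Matrix (Fin n) (Fin n) ℂ), 1 ≤ n → τ.trace = 1 → ω.trace = 1 →
      (wassersteinGMP n τ ω).RelintAssumption ∨ (τ.PosDef ∧ ω.PosDef) →
        WassersteinDualAttained n τ ω ∧ (wassersteinGMP n τ ω).DualityAttainment ∧
        ∀ t : ℕ, (wassersteinGMP n τ ω).tMin ≤ t →
          (wassersteinGMP n τ ω).RelaxDualityAttainment t) ∧
    (∀ (a : ℕ) (n : Fin a → ℕ) (A : ((l : Fin a) → Fin (n l)) → ℝ), (∀ l, 1 ≤ n l) →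
      (tensorGMP n A).DualityAttainment ∧
      ∀ t : ℕ, (tensorGMP n A).tMin ≤ t → (tensorGMP n A).RelaxDualityAttainment t) :=
  ⟨fun _ _ hn h => dps_attainment hn h, fun _ _ _ hn hτ hω h => wasserstein_attainment hn hτ hω h,
    fun _ _ A hn => tensor_attainment A hn⟩
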